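/- **Market.** Let $N$ (buyers) and $M$ (goods) be finite sets and $s\in\mathbb Z_+^M$ a supply vector. Each buyer $i$ has a normalized, monotone, $\mathrm M^\natural$-concave valuation $v_i:\{x\in\mathbb Z_+^M: x\le s\}\to\mathbb R_+$ and, for each good $j$, a continuous, piecewise linear, strictly increasing payment function $q_{ij}:\mathbb R_+\to\mathbb R_+$ with $q_{ij}(0)=0$ that attains the value $v_i(\chi_j)$ (if $s_j>0$); $q_{ij}'$ is its right derivative. Fix prices $p\in\mathbb R_+^M$. Let $D_i$ be the set of bundles $0\le x\le s$ maximizing $v_i(x)-\sum_j q_{ij}(p_j)x_j$, let $\check D_i$ be the set of minimal elements of $D_i$, and let $\check\rho_i(S)=\max_{x\in\check D_i}x(S)$. Let $X^*$ be the minimal maximizer of $\mathcal O(S)=\sum_i\min_{x\in D_i}x(S)-s(S)$ over $S\subseteq M$. For a set function $\rho$ write $P(\rho)=\{x\ge 0\text{ integral}: x(S)\le\rho(S)\ \forall S\}$, and let $\tilde\rho_i(S)=\check\rho_i(S\cup(M\setminus X^*))-\check\rho_i(M\setminus X^*)$ for $S\subseteq X^*$. **Weights.** Let $\Gamma$ be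 the ordered group of numbers $a+\gamma b$ with $a,b\in\mathbb R$ and $\gamma>0$ infinitesimal, i.e. pairs $(a,b)$ added componentwise and ordered lexicographically. Put $w_{ij}=1-\gamma\log q_{ij}'(p_j)\in\Gamma$. Consider $$(P_2)\ \max\Big\{\sum_{i,j}w_{ij}x_{ij}: x_i\in P(\check\rho_i)\ \forall i,\ \sum_i x_i\le s\Big\},\qquad (D_2)\ \min_{z\in\Gamma^M,\,z\ge 0}\ \sum_i\max_{x\in P(\check\rho_i)}\sum_j(w_{ij}-z_j)x_j+\sum_j s_jz_j .$$ **Statement.** $(D_2)$ has a least minimizer $z^*$, and it has the form $z^*=\chi_{X^*}+\gamma t$ with $t\in\mathbb R^M$. Let $d^*_j=e^{t_j}$ for $j\in X^*$ and $d^*_j=0$ for $j\notin X^*$, so that $z^*_j=1+\gamma\log d^*_j$ for $j\in X^*$. Then: 1. On $X^*$ with supply $s|_{X^*}$ consider the frictionless market in which buyer $i$ has the valuation $\tilde v_i(y)=\sum_{j\in X^*}w_{ij}y_j$ for $y\in P(\tilde\rho_i)$ and $\tilde v_i(y)=-\infty$ otherwise. The restriction $z^*|_{X^*}$ is the least (hence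 the unique minimal) minimizer over $z'\in\Gamma^{X^*}$, $z'\ge0$, of the Lyapunov function $$\sum_i\max_{0\le y\le s|_{X^*}}\Big(\tilde v_i(y)-\sum_{j\in X^*}z'_jy_j\Big)+\sum_{j\in X^*}s_jz'_j ,$$ and it is the minimum equilibrium price vector of this market (each buyer gets a utility-maximizing bundle, and the bundles sum to $s|_{X^*}$). 2. There are an optimal solution $x$ of $(P_2)$ and bundles $b_i\in\check D_i$ with $b_i\ge x_i$ for all $i$. For every such $x,b$ form the assignment market with goods $X^*$ and supply $s|_{X^*}$ that has $b_{ij}$ unit-demand copies of buyer $i$ holding $j$ for each $i\in N$, $j\in X^*$; such a copy accepts $j$ and every $j'\in X^*$ with $b_i-\chi_j+\chi_{j'}\in\check D_i$, values $j'$ at $w_{ij'}$, and has an outside option of value $0$. Then $z^*|_{X^*}$ is the minimum equilibrium price vector of this market (each copy gets a best option among its acceptable goods and the outside option, and exactly $s_j$ units of each $j$ are sold). These prices are the VCG prices: efficient assignments exist, and in each of them every $j\in X^*$ is assigned to some copy, and the VCG payment of every copy that receives $j$ equals $z^*_j=1+\gamma\log d^*_j$. -/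

import Mathlib

open Finset

noncomputable section

/-! ### Ordered values

A number `a + γ b` with `γ` an infinitesimal is the pair `(a, b)`, added componentwise and
compared lexicographically. The general notions below are stated over a linearly ordered
abelian group `V` of values. -/

/-- Numbers `a + γ b`, `a b : ℝ`, with the lexicographic order. -/
abbrev LexReal : Type := ℝ ×ₗ ℝ

/-- Minimizers of an objective over nonnegative price vectors. -/
def minimizers {J V W : Type*} [AddCommGroup V] [LinearOrder V] [LE W]
    (f : (J → V) → W) : Set (J → V) :=
  {z | 0 ≤ z ∧ ∀ z', 0 ≤ z' → f z ≤ f z'}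

/-! ### Integral polymatroids -/

/-- The integral polymatroid `P(ρ)`. The componentwise bound `x j ≤ ρ {j}` only makes the set
visibly finite; it is the constraint for the singletons, see `mem_polymatroid`. -/
def polymatroid {J : Type*} [Fintype J] [DecidableEq J] (ρ : Finset J → ℕ) : Finset (J → ℕ) :=
  (Finset.Iic (fun j => ρ {j})).filter (fun x => ∀ S : Finset J, ∑ j ∈ S, x j ≤ ρ S)

theorem mem_polymatroid {J : Type*} [Fintype J] [DecidableEq J] (ρ : Finset J → ℕ) (x : J → ℕ) :
    x ∈ polymatroid ρ ↔ ∀ S : Finset J, ∑ j ∈ S, x j ≤ ρ S := by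
  simp only [polymatroid, Finset.mem_filter, Finset.mem_Iic, and_iff_right_iff_imp]
  intro h j
  simpa using h {j}

theorem polymatroid_nonempty {J : Type*} [Fintype J] [DecidableEq J] (ρ : Finset J → ℕ) :
    (polymatroid ρ).Nonempty :=
  ⟨0, (mem_polymatroid ρ 0).2 (by simp)⟩

/-- The rank function on `X` obtained by contracting the complement of `X`. -/
def contractOnto {M : Type*} [Fintype M] [DecidableEq M] (ρ : Finset M → ℕ) (X : Finset M) :
    Finset {j // j ∈ X} → ℕ :=
  fun S => ρ (S.map (Function.Embedding.subtype _) ∪ Xᶜ) - ρ Xᶜ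

/-! ### Frictionless markets with valuations in `V ∪ {-∞}` -/

section Frictionless

variable {N J V : Type*} [Fintype N] [Fintype J] [DecidableEq J] [AddCommGroup V] [LinearOrder V]

/-- Utility `v(y) - ⟨z, y⟩` at prices `z`. -/
def utility (v : (J → ℕ) → WithBot V) (z : J → V) (y : J → ℕ) : WithBot V :=
  v y + ((-∑ j, y j • z j : V) : WithBot V)

/-- The Lyapunov function
`z ↦ ∑ i, max_{0 ≤ y ≤ s} (v i y - ⟨z, y⟩) + ⟨s, z⟩`. -/
def lyapunov (s : J → ℕ) (v : N → (J → ℕ) → WithBot V) (z : J → V) : WithBot V :=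
  ∑ i, (Finset.Iic s).sup (utility (v i) z) + ((∑ j, s j • z j : V) : WithBot V)

/-- `z` is a (Walrasian) equilibrium price vector: some allocation gives every buyer a utility
maximizing bundle and clears the market. -/
def IsEquilibriumPrice (s : J → ℕ) (v : N → (J → ℕ) → WithBot V) (z : J → V) : Prop :=
  0 ≤ z ∧ ∃ y : N → J → ℕ,
    (∀ i, y i ≤ s ∧ ∀ y' ≤ s, utility (v i) z y' ≤ utility (v i) z (y i)) ∧ ∑ i, y i = s

/-- The valuation that is linear with weights `w` on `P(ρ)` and `-∞` elsewhere. -/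
def linearValuation (ρ : Finset J → ℕ) (w : J → V) (y : J → ℕ) : WithBot V :=
  if y ∈ polymatroid ρ then ((∑ j, y j • w j : V) : WithBot V) else ⊥

end Frictionless

/-! ### Assignment markets with unit-demand buyers -/

/-- Buyers `K` want at most one unit each; buyer `k` accepts the goods `j` with `edge k j` and
values such a good at `value k j`; the outside option has value `0`. -/
structure AssignmentMarket (K J V : Type*) where
  edge : K → J → Prop
  value : K → J → V
  supply : J → ℕ

namespace AssignmentMarket

variable {K J V : Type*} [Fintype K] [Fintype J] [AddCommGroup V] [LinearOrder V]
  (A : AssignmentMarket K J V)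

open Classical in
/-- Number of units of good `j` used by the assignment `y`. -/
def sold (y : K → Option J) (j : J) : ℕ := (univ.filter (fun k => y k = some j)).card

/-- Every buyer gets nothing or one unit of an acceptable good, within the supply. -/
def IsAssignment (y : K → Option J) : Prop :=
  (∀ k j, y k = some j → A.edge k j) ∧ ∀ j, sold y j ≤ A.supply j

/-- Surplus of buyer `k` from an option at prices `z`. -/
def surplus (z : J → V) (k : K) : Option J → V
  | none => 0
  | some j => A.value k j - z j

/-- `z` is an equilibrium price vector: some assignment sells exactly the supply and gives each
buyer a best option among the acceptable goods and the outside option. -/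
def IsEquilibriumPrice (z : J → V) : Prop :=
  0 ≤ z ∧ ∃ y : K → Option J, (∀ k j, y k = some j → A.edge k j) ∧
    (∀ j, sold y j = A.supply j) ∧
    ∀ k, 0 ≤ A.surplus z k (y k) ∧ ∀ j, A.edge k j → A.value k j - z j ≤ A.surplus z k (y k)

/-- Total value to the buyers in `B` of the assignment `y`. -/
def welfare (B : Finset K) (y : K → Option J) : V := ∑ k ∈ B, A.surplus 0 k (y k)

open Classical in
/-- Assignments that give nothing to buyers outside `B`. -/
def assignmentsOf (B : Finset K) : Finset (K → Option J) :=
  univ.filter (fun y => A.IsAssignment y ∧ ∀ k, k ∉ B → y k = none)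

open Classical in
theorem assignmentsOf_nonempty (B : Finset K) : (A.assignmentsOf B).Nonempty := by
  refine ⟨fun _ => none, ?_⟩
  exact mem_filter.2 ⟨mem_univ _, ⟨by simp, by simp [sold]⟩, by simp⟩

/-- The largest total value that the buyers in `B` can attain on their own. -/
def maxWelfare (B : Finset K) : V :=
  (A.assignmentsOf B).sup' (A.assignmentsOf_nonempty B) (A.welfare B)

/-- A welfare-maximizing assignment. -/
def IsEfficient (y : K → Option J) : Prop :=
  A.IsAssignment y ∧ ∀ y', A.IsAssignment y' → A.welfare univ y' ≤ A.welfare univ y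

open Classical in
/-- Vickrey–Clarke–Groves payment of buyer `k` at the efficient assignment `y`: the loss that
the presence of `k` causes to the other buyers. -/
def vcgPayment (y : K → Option J) (k : K) : V :=
  A.maxWelfare (univ.erase k) - A.welfare (univ.erase k) y

end AssignmentMarket

/-! ### The market with payment functions -/

/-- `M♮`-concavity of a valuation on the bundles `0 ≤ x ≤ s` (it is `-∞` elsewhere). -/
def MNatConcaveOn {M : Type*} [DecidableEq M] (s : M → ℕ) (v : (M → ℕ) → ℝ) : Prop :=
  ∀ x ≤ s, ∀ x' ≤ s, ∀ j, x' j < x j →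
    v x + v x' ≤ v (x - Pi.single j 1) + v (x' + Pi.single j 1) ∨
    ∃ k, x k < x' k ∧
      v x + v x' ≤ v (x - Pi.single j 1 + Pi.single k 1) + v (x' + Pi.single j 1 - Pi.single k 1)

/-- `q` is piecewise linear on `[0, ∞)`: on each bounded interval `[0, R]` it is affine on each
subinterval without interior breakpoint, for some finite set of breakpoints. -/
def PiecewiseLinear (q : ℝ → ℝ) : Prop :=
  ∀ R : ℝ, ∃ F : Finset ℝ, ∀ a b : ℝ, 0 ≤ a → a < b → b ≤ R → (∀ c ∈ F, ¬(a < c ∧ c < b)) →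
    ∃ α β : ℝ, ∀ r ∈ Set.Icc a b, q r = α * r + β

/-- A market: `supply j` units of each good `j`, strong substitutes valuations `val i` on the
bundles `0 ≤ x ≤ supply`, and the payment `pay i j r` of buyer `i` for one unit of good `j` at
price `r ≥ 0`. Values of `val` and `pay` outside these domains play no role. -/
structure Market (N M : Type*) [DecidableEq M] where
  supply : M → ℕ
  val : N → (M → ℕ) → ℝ
  pay : N → M → ℝ → ℝ
  val_nonneg : ∀ i, ∀ x ≤ supply, 0 ≤ val i x
  val_zero : ∀ i, val i 0 = 0
  val_mono : ∀ i x y, x ≤ y → y ≤ supply → val i x ≤ val i y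
  val_mNatConcave : ∀ i, MNatConcaveOn supply (val i)
  pay_zero : ∀ i j, pay i j 0 = 0
  pay_continuous : ∀ i j, ContinuousOn (pay i j) (Set.Ici 0)
  pay_piecewiseLinear : ∀ i j, PiecewiseLinear (pay i j)
  pay_strictMono : ∀ i j, StrictMonoOn (pay i j) (Set.Ici 0)
  pay_reaches : ∀ i j, 0 < supply j → ∃ r, 0 ≤ r ∧ pay i j r = val i (Pi.single j 1)

namespace Market

variable {N M : Type*} [Fintype N] [Fintype M] [DecidableEq M] (E : Market N M) (p : M → ℝ)

/-- Utility `u_i(x; p)`. -/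
def util (i : N) (x : M → ℕ) : ℝ := E.val i x - ∑ j, E.pay i j (p j) * (x j : ℝ)

open Classical in
/-- The demand set `D_i(p)`. -/
def demand (i : N) : Finset (M → ℕ) :=
  (Finset.Iic E.supply).filter (fun x => ∀ y ≤ E.supply, E.util p i y ≤ E.util p i x)

open Classical in
/-- The set of minimal elements of `D_i(p)`. -/
def minDemand (i : N) : Finset (M → ℕ) :=
  (E.demand p i).filter (fun x => ∀ y ∈ E.demand p i, y ≤ x → y = x)

/-- The rank function of the minimal demand set: `S ↦ max {x(S) | x ∈ minDemand}`. -/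
def rank (i : N) (S : Finset M) : ℕ := (E.minDemand p i).sup (fun x => ∑ j ∈ S, x j)

/-- The requirement function `μ_i(S; p) = min {x(S) | x ∈ D_i(p)}`. -/
def requirement (i : N) (S : Finset M) : ℕ :=
  sInf ((fun x : M → ℕ => ∑ j ∈ S, x j) '' (E.demand p i : Set (M → ℕ)))

/-- The over-demand function. -/
def overDemand (S : Finset M) : ℤ :=
  (∑ i, (E.requirement p i S : ℤ)) - ∑ j ∈ S, (E.supply j : ℤ)

/-- `S` maximizes the over-demand function. -/
def IsMaxOverDemanded (S : Finset M) : Prop := ∀ T, E.overDemand p T ≤ E.overDemand p S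

/-- Right derivative of the payment function at the current price. -/
def payRate (i : N) (j : M) : ℝ := derivWithin (E.pay i j) (Set.Ioi (p j)) (p j)

/-- The weight `w i j = 1 - γ log q'_{ij}(p_j)`. -/
def weight (i : N) (j : M) : LexReal := toLex (1, -Real.log (E.payRate p i j))

/-- Feasibility in the weighted polymatroid sum problem: `x i ∈ P(ρ i)` and `∑ i, x i ≤ s`. -/
def IsFeasiblePrimal (x : N → M → ℕ) : Prop :=
  (∀ i, x i ∈ polymatroid (E.rank p i)) ∧ ∑ i, x i ≤ E.supply

/-- `x` solves: maximize `∑ i, ∑ j, w i j * x i j` subject to `x i ∈ P(ρ i)`, `∑ i, x i ≤ s`. -/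
def IsOptimalPrimal (x : N → M → ℕ) : Prop :=
  E.IsFeasiblePrimal p x ∧ ∀ x', E.IsFeasiblePrimal p x' →
    ∑ i, ∑ j, x' i j • E.weight p i j ≤ ∑ i, ∑ j, x i j • E.weight p i j

/-- The dual objective
`z ↦ ∑ i, max_{x ∈ P(ρ i)} ∑ j, (w i j - z j) * x j + ∑ j, s j * z j`. -/
def dualObjective (z : M → LexReal) : LexReal :=
  ∑ i, (polymatroid (E.rank p i)).sup' (polymatroid_nonempty _)
      (fun x => ∑ j, x j • (E.weight p i j - z j))
    + ∑ j, E.supply j • z j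

open Classical in
/-- The price direction read off from a dual solution `z = (z⁰, z¹)`:
`exp (z¹ j)` where `z⁰ j = 1`, and `0` elsewhere. -/
def direction (z : M → LexReal) (j : M) : ℝ :=
  if (ofLex (z j)).1 = 1 then Real.exp (ofLex (z j)).2 else 0

/-- Supply of the auxiliary markets on the goods in `X`. -/
def auxSupply (X : Finset M) (j : {j // j ∈ X}) : ℕ := E.supply j

/-- Valuations of the auxiliary frictionless market on `X`: linear with weights `w i` on the
polymatroid `P(ρ i)` contracted by the complement of `X`, and `-∞` elsewhere. -/
def auxValuation (X : Finset M) (i : N) : ({j // j ∈ X} → ℕ) → WithBot LexReal :=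
  linearValuation (contractOnto (E.rank p i) X) (fun j => E.weight p i j)

/-- Unit-demand copies of the buyers for the bundles `b`: one for each unit of a good in `X`. -/
abbrev Copies (X : Finset M) (b : N → M → ℕ) : Type _ :=
  Σ i : N, Σ j : {j // j ∈ X}, Fin (b i j)

/-- The auxiliary assignment market on `X` for bundles `b i ∈ minDemand i`. A copy of `i` that
holds good `j` accepts `j` and every good `j' ∈ X` that `i` can swap for `j` within its minimal
demand set; its value for `j'` is `w i j'`. -/
def exchangeMarket (X : Finset M) (b : N → M → ℕ) :
    AssignmentMarket (Copies X b) {j // j ∈ X} LexReal where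
  edge k j' := j' = k.2.1 ∨
    b k.1 - Pi.single (k.2.1 : M) 1 + Pi.single (j' : M) 1 ∈ E.minDemand p k.1
  value k j' := E.weight p k.1 j'
  supply := E.auxSupply X

end Market

end

open Finset

noncomputable section

set_option linter.unusedSectionVars false

/-! The minimal demand sets are M-convex, and the polymatroid of `rank` is the lower closure of the
minimal demand set (`mConvex_minDemand`, `mem_polymatroid_rankOf`). So the dual problem prices a
market in which buyers with linear weights choose parts of bundles from M-convex sets. Prices are
competitive at supply `s` if the buyers have optimal parts that fit into `s` and unsold goods are
free; such prices minimize the dual objective `L_s`.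

Everything rests on one price vector `z` that is competitive at `s` and at each `s + χ_j`
(`exists_isCompetitive`). Since `z` then minimizes both `L_s` and `L_{s+χ_j}`, where `L_{s+χ_j}(z')
= L_s(z') + z'_j`, every minimizer `z'` of `L_s` satisfies `z_j ≤ z'_j` (`price_le_of_augment`).
Hence `z` is least, and the same comparison on the goods of `X` settles the Lyapunov function and
the frictionless equilibria. To construct `z`, prices are lowered until every good can be reached
from a worthless unit by a chain of swaps within the demand sets; a shortest chain then supplies one
more unit at unchanged prices. Induction on the total supply starts this process.

The price `z_j` is the marginal value of a unit of `j`. All weights have main part 1, so the main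
part of `z_j` is the marginal size of a largest feasible allocation, which is 0 or 1. Complementary
slackness in the min-max formula for that size shows that the goods with main part 1 form the
minimal maximizer of the over-demand function (`mainPart_price`).

In the exchange market, optimality over an M-convex set is a condition on single swaps, so `z`
supports the assignment read off from an optimal allocation. If equilibrium prices there were below
`z` at some good, `z` could be lowered a little on such goods and stay dual optimal, against its
minimality (`isDualPair_lower`). For VCG, at the least prices the good of a copy is reachable by a
chain that avoids this copy, so without the copy the others absorb its unit at the same prices
(`IsCompetitive.exists_without`); the harm done by the copy is the price. -/

namespace DiscreteConvex

/-! ### M-convex sets: local optimality and composition of exchanges. -/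

section Exchange

variable {G V : Type*} [Fintype G] [DecidableEq G] [AddCommGroup V] [LinearOrder V]
  [IsOrderedAddMonoid V]

/-- `x ↦ ∑ g, x g • c g` as an additive map. -/
def pairing (c : G → V) : (G → ℤ) →+ V where
  toFun x := ∑ g, x g • c g
  map_zero' := by simp
  map_add' x y := by simp [add_smul, sum_add_distrib]

theorem pairing_apply (c : G → V) (x : G → ℤ) : pairing c x = ∑ g, x g • c g := rfl

@[simp]
theorem pairing_single (c : G → V) (g : G) : pairing c (Pi.single g 1) = c g := by
  rw [pairing_apply, sum_eq_single g] <;> simp +contextual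

/-- Symmetric exchange property of M-convex sets of integer vectors. -/
def MConvex (B : Set (G → ℤ)) : Prop :=
  ∀ x ∈ B, ∀ y ∈ B, ∀ j, y j < x j → ∃ k, x k < y k ∧
    x - Pi.single j 1 + Pi.single k 1 ∈ B ∧ y + Pi.single j 1 - Pi.single k 1 ∈ B

/-- Maximizers over `B` of the linear functional with coefficients `c`. -/
def argmaxOn (B : Set (G → ℤ)) (c : G → V) : Set (G → ℤ) :=
  {x | x ∈ B ∧ ∀ y ∈ B, pairing c y ≤ pairing c x}

variable {B : Set (G → ℤ)} {c : G → V} {x y : G → ℤ}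

/-- Exchanging between `x` and `y` moves `y` one step closer to `x`, and the matching swap at `x`
shows that this step does not decrease the value of `y`. Induction on the distance concludes. -/
theorem MConvex.le_of_local (hB : MConvex B) (hx : x ∈ B)
    (h : ∀ k l, x - Pi.single k 1 + Pi.single l 1 ∈ B → c l ≤ c k) (hy : y ∈ B) :
    pairing c y ≤ pairing c x := by
  induction hn : ∑ g, (x g - y g).natAbs using Nat.strong_induction_on generalizing y with
  | _ n ih =>
    by_cases hxy : y = x
    · rw [hxy]
    obtain ⟨j, hj⟩ : ∃ j, y j < x j := by
      by_contra! hle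
      obtain ⟨j, hj⟩ := Function.ne_iff.1 hxy
      obtain ⟨k, hk, -⟩ := hB y hy x hx j (lt_of_le_of_ne (hle j) (Ne.symm hj))
      exact absurd (hle k) (not_le.2 hk)
    obtain ⟨k, hk, h1, h2⟩ := hB x hx y hy j hj
    have hlt : ∑ g, (x g - (y + Pi.single j 1 - Pi.single k 1 : G → ℤ) g).natAbs < n := by
      rw [← hn]
      refine sum_lt_sum (fun g _ => ?_) ⟨j, mem_univ _, ?_⟩
      · simp only [Pi.add_apply, Pi.sub_apply, Pi.single_apply]
        split_ifs with a b b <;> (try subst a) <;> (try subst b) <;> omega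
      · have : k ≠ j := by rintro rfl; omega
        simp only [Pi.add_apply, Pi.sub_apply, Pi.single_apply, this.symm]
        simp
        omega
    have := ih _ hlt h2 rfl
    rw [map_sub, map_add, pairing_single, pairing_single] at this
    have h3 := h j k h1
    calc pairing c y = (pairing c y + c j - c k) - (c j - c k) := by abel
      _ ≤ pairing c x - 0 := sub_le_sub this (sub_nonneg.2 h3)
      _ = pairing c x := sub_zero _

theorem mem_argmaxOn_iff (hB : MConvex B) (hx : x ∈ B) :
    x ∈ argmaxOn B c ↔ ∀ k l, x - Pi.single k 1 + Pi.single l 1 ∈ B → c l ≤ c k := by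
  refine ⟨fun h k l hkl => ?_, fun h => ⟨hx, fun y => hB.le_of_local hx h⟩⟩
  have := h.2 _ hkl
  rw [map_add, map_sub, pairing_single, pairing_single, sub_add, sub_le_self_iff] at this
  exact sub_nonneg.1 this

theorem exchange_mem_argmaxOn (hx : x ∈ argmaxOn B c) {k l : G} :
    x - Pi.single k 1 + Pi.single l 1 ∈ argmaxOn B c ↔
      x - Pi.single k 1 + Pi.single l 1 ∈ B ∧ c l = c k := by
  have key : pairing c (x - Pi.single k 1 + Pi.single l 1) = pairing c x - (c k - c l) := by
    rw [map_add, map_sub, pairing_single, pairing_single, sub_add]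
  constructor
  · intro h
    have h1 := h.2 _ hx.1
    have h2 := hx.2 _ h.1
    have h3 := le_antisymm h1 h2
    rw [key, eq_comm, sub_eq_self, sub_eq_zero] at h3
    exact ⟨h.1, h3.symm⟩
  · rintro ⟨h1, h2⟩
    refine ⟨h1, fun y hy => ?_⟩
    rw [key, h2, sub_self, sub_zero]
    exact hx.2 y hy

/-- An exchange preserves the sum of the two values. As neither can exceed the maximum, both stay
maximal. -/
theorem MConvex.argmaxOn (hB : MConvex B) (c : G → V) : MConvex (argmaxOn B c) := by
  intro x hx y hy j hj
  obtain ⟨k, hk, h1, h2⟩ := hB x hx.1 y hy.1 j hj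
  have e1 := hx.2 _ h1
  have e2 := hy.2 _ h2
  rw [map_add, map_sub, pairing_single, pairing_single, sub_add, sub_le_self_iff,
    sub_nonneg] at e1
  rw [map_sub, map_add, pairing_single, pairing_single, add_sub_assoc, add_le_iff_nonpos_right,
    sub_nonpos] at e2
  have hjk := le_antisymm e1 e2
  refine ⟨k, hk, (exchange_mem_argmaxOn hx).2 ⟨h1, hjk⟩, ?_⟩
  have : y + Pi.single j 1 - Pi.single k 1 = y - Pi.single k 1 + Pi.single j 1 := by abel
  rw [this] at h2 ⊢
  exact (exchange_mem_argmaxOn hy).2 ⟨h2, hjk.symm⟩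

/-- Exchange the unit of `k` between the two given points: the only coordinates that can compensate
are `l` and `j`, and each of them yields the claim. -/
theorem MConvex.exchange_trans (hB : MConvex B) (hx : x ∈ B) {j k l : G}
    (h1 : x - Pi.single k 1 + Pi.single j 1 ∈ B) (h2 : x - Pi.single l 1 + Pi.single k 1 ∈ B) :
    x - Pi.single l 1 + Pi.single j 1 ∈ B := by
  by_cases hjk : j = k
  · rwa [hjk]
  by_cases hkl : k = l
  · rwa [← hkl]
  by_cases hjl : j = l
  · rw [hjl]; simpa using hx
  obtain ⟨m, hm, h3, h4⟩ := hB _ h2 _ h1 k (by simp [hkl, Ne.symm hjk])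
  have : m = l ∨ m = j := by
    by_contra! hne
    simp only [Pi.add_apply, Pi.sub_apply, Pi.single_apply, hne.1, hne.2] at hm
    split_ifs at hm <;> omega
  rcases this with rfl | rfl
  · convert h4 using 1; abel
  · convert h3 using 1; abel

/-- Two swaps can be carried out together when the shortcut from `k₀` to `l` is missing. This keeps
the remainder of a shortest swap path valid after its first swap. -/
theorem MConvex.exchange_exchange (hB : MConvex B) {k₀ k₁ k l : G}
    (h1 : x - Pi.single k₀ 1 + Pi.single k₁ 1 ∈ B) (h2 : x - Pi.single k 1 + Pi.single l 1 ∈ B)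
    (h3 : x - Pi.single k₀ 1 + Pi.single l 1 ∉ B) (hl : l ≠ k₀) :
    x - Pi.single k₀ 1 + Pi.single k₁ 1 - Pi.single k 1 + Pi.single l 1 ∈ B := by
  by_cases hkl : k = l
  · rw [hkl]; simpa using h1
  have hl1 : l ≠ k₁ := by rintro rfl; exact h3 h1
  obtain ⟨m, hm, -, h4⟩ := hB _ h2 _ h1 l (by simp [hl, hl1, Ne.symm hkl])
  have : m = k ∨ m = k₁ := by
    by_contra! hne
    simp only [Pi.add_apply, Pi.sub_apply, Pi.single_apply, hne.1, hne.2] at hm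
    split_ifs at hm <;> omega
  rcases this with rfl | rfl
  · convert h4 using 1; abel
  · exact absurd (by convert h4 using 1; abel) h3

end Exchange

/-! ### Augmentation along shortest swap paths. -/

section Augment

variable {G I : Type*} [Fintype G] [DecidableEq G]

/-- Some agent can swap a unit of `k` for a unit of `l` at `x`. -/
def Swap (D : I → Set (G → ℤ)) (x : I → G → ℤ) (k l : G) : Prop :=
  ∃ i, x i - Pi.single k 1 + Pi.single l 1 ∈ D i

/-- There is a path with a given number of edges. -/
inductive Steps {α : Type*} (r : α → α → Prop) (c : α) : ℕ → α → Prop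
  | refl : Steps r c 0 c
  | head {n : ℕ} {a b : α} : r a b → Steps r c n b → Steps r c (n + 1) a

theorem exists_steps {α : Type*} {r : α → α → Prop} {a c : α} (h : Relation.ReflTransGen r a c) :
    ∃ n, Steps r c n a := by
  induction h using Relation.ReflTransGen.head_induction_on with
  | refl => exact ⟨0, .refl⟩
  | head h _ ih => exact ih.imp' _ fun _ => .head h

theorem exists_augment_of_steps [Fintype I] [DecidableEq I] {D : I → Set (G → ℤ)}
    (hD : ∀ i, MConvex (D i)) {x : I → G → ℤ} (hx : ∀ i, x i ∈ D i) {j k : G} {n : ℕ}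
    (h : Steps (Swap D x) j n k) :
    ∃ x' : I → G → ℤ, (∀ i, x' i ∈ D i) ∧
      ∑ i, x' i = ∑ i, x i - Pi.single k 1 + Pi.single j 1 := by
  induction n using Nat.strong_induction_on generalizing x k with
  | _ n ih =>
    -- It suffices to treat a shortest path, which has no shortcuts.
    by_cases hmin : ∃ m < n, Steps (Swap D x) j m k
    · obtain ⟨m, hm, hs⟩ := hmin
      exact ih m hm hx hs
    push Not at hmin
    cases h with
    | refl => exact ⟨x, hx, by abel⟩
    | @head n _ k₁ h hs =>
      obtain ⟨i, hi⟩ := h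
      set x₁ := Function.update x i (x i - Pi.single k 1 + Pi.single k₁ 1) with hx₁
      have hx₁D : ∀ i', x₁ i' ∈ D i' := by
        intro i'
        by_cases hii : i' = i
        · subst hii; simpa [hx₁] using hi
        · simpa [hx₁, hii] using hx i'
      -- Perform the first swap. A later swap of the same agent survives, since a direct swap from
      -- `k` to its head `l`, or `l = k`, would give a shorter path.
      have key : ∀ m a, m ≤ n → Steps (Swap D x) j m a → Steps (Swap D x₁) j m a := by
        intro m a hm hst
        induction hst with
        | refl => exact .refl
        | @head m a l hal hl ih' =>
          refine .head ?_ (ih' (by omega))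
          obtain ⟨i', hi'⟩ := hal
          by_cases hii : i' = i
          · subst hii
            refine ⟨i', ?_⟩
            rw [hx₁, Function.update_self]
            refine (hD i').exchange_exchange hi hi' (fun hkl => ?_) ?_
            · exact hmin _ (by omega) (.head ⟨i', hkl⟩ hl)
            · rintro rfl
              exact hmin _ (by omega) hl
          · exact ⟨i', by simpa [hx₁, hii] using hi'⟩
      obtain ⟨x', hx', hsum⟩ := ih n (by omega) hx₁D (key n k₁ le_rfl hs)
      refine ⟨x', hx', ?_⟩
      rw [hsum, hx₁, sum_update_of_mem (mem_univ i), ← add_sum_erase _ x (mem_univ i),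
        sdiff_singleton_eq_erase]
      abel

theorem exists_augment [Fintype I] {D : I → Set (G → ℤ)} (hD : ∀ i, MConvex (D i))
    {x : I → G → ℤ} (hx : ∀ i, x i ∈ D i) {j k : G}
    (h : Relation.ReflTransGen (Swap D x) k j) :
    ∃ x' : I → G → ℤ, (∀ i, x' i ∈ D i) ∧
      ∑ i, x' i = ∑ i, x i - Pi.single k 1 + Pi.single j 1 := by
  classical
  obtain ⟨n, hn⟩ := exists_steps h
  exact exists_augment_of_steps hD hx hn

end Augment

/-! ### Lowering prices until all goods are reachable. -/

section Reach

variable {G I V : Type*} [Fintype G] [DecidableEq G] [Fintype I] [AddCommGroup V] [LinearOrder V]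
  [IsOrderedAddMonoid V]

/-- Prices can be lowered outside of `O` until every good is reachable from `O` by swaps within
the demand sets. -/
theorem exists_reachable {B : I → Set (G → ℤ)} (hB : ∀ i, MConvex (B i)) (w : I → G → V)
    (O : Set G) {x : I → G → ℤ}
    (hO : ∀ g ∉ O, ∃ o ∈ O, ∃ i, x i - Pi.single o 1 + Pi.single g 1 ∈ B i)
    (z : G → V) (hx : ∀ i, x i ∈ argmaxOn (B i) (w i - z)) :
    ∃ z' ≤ z, (∀ g ∈ O, z' g = z g) ∧ (∀ i, x i ∈ argmaxOn (B i) (w i - z')) ∧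
      ∀ g, ∃ o ∈ O,
        Relation.ReflTransGen (Swap (fun i => argmaxOn (B i) (w i - z')) x) o g := by
  classical
  let R (z : G → V) (g : G) : Prop := ∃ o ∈ O,
    Relation.ReflTransGen (Swap (fun i => argmaxOn (B i) (w i - z)) x) o g
  change ∃ z' ≤ z, (∀ g ∈ O, z' g = z g) ∧ (∀ i, x i ∈ argmaxOn (B i) (w i - z')) ∧ ∀ g, R z' g
  induction hn : #{g | ¬ R z g} using Nat.strong_induction_on generalizing z with
  | _ n ih =>
    by_cases hall : ∀ g, R z g
    · exact ⟨z, le_rfl, fun _ _ => rfl, hx, hall⟩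
    push Not at hall
    obtain ⟨g₀, hg₀⟩ := hall
    have hRO : ∀ o ∈ O, R z o := fun o ho => ⟨o, ho, .refl⟩
    have hstep : ∀ i k l, x i - Pi.single k 1 + Pi.single l 1 ∈ B i →
        (w i - z) l ≤ (w i - z) k := fun i => (mem_argmaxOn_iff (hB i) (hx i).1).1 (hx i)
    -- Exchanges that leave the reached goods. Their smallest loss `δ` is how far the unreached
    -- prices can fall before one of them becomes free of loss.
    let A : Finset (I × G × G) :=
      univ.filter fun a => R z a.2.1 ∧ ¬ R z a.2.2 ∧
        x a.1 - Pi.single a.2.1 1 + Pi.single a.2.2 1 ∈ B a.1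
    have hA : A.Nonempty := by
      obtain ⟨o, ho, i, hi⟩ := hO g₀ (fun h => hg₀ (hRO _ h))
      exact ⟨(i, o, g₀), by simp only [A, mem_filter, mem_univ, true_and]; exact ⟨hRO o ho, hg₀, hi⟩⟩
    obtain ⟨⟨i₀, k₀, l₀⟩, ha₀, hmin⟩ :=
      A.exists_min_image (fun a => (w a.1 - z) a.2.1 - (w a.1 - z) a.2.2) hA
    simp only [A, mem_filter, mem_univ, true_and] at ha₀ hmin
    obtain ⟨hk₀, hl₀, hB₀⟩ := ha₀
    set δ := (w i₀ - z) k₀ - (w i₀ - z) l₀ with hδ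
    have hδ0 : 0 ≤ δ := sub_nonneg.2 (hstep _ _ _ hB₀)
    -- Swaps among reached goods keep their gain, and a minimizing exchange becomes a demanded swap,
    -- so at least one further good is reached.
    let z' : G → V := fun g => if R z g then z g else z g - δ
    have hz'R : ∀ g, R z g → z' g = z g := fun g h => if_pos h
    have hz'N : ∀ g, ¬ R z g → z' g = z g - δ := fun g h => if_neg h
    have hz' : z' ≤ z := by
      intro g
      by_cases h : R z g
      · rw [hz'R g h]
      · rw [hz'N g h]; exact sub_le_self _ hδ0
    have hx' : ∀ i, x i ∈ argmaxOn (B i) (w i - z') := by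
      intro i
      rw [mem_argmaxOn_iff (hB i) (hx i).1]
      intro k l hkl
      have h1 := hstep i k l hkl
      simp only [Pi.sub_apply] at h1 ⊢
      by_cases hk : R z k <;> by_cases hl : R z l
      · rwa [hz'R k hk, hz'R l hl]
      · rw [hz'R k hk, hz'N l hl]
        have := hmin (i, k, l) ⟨hk, hl, hkl⟩
        simp only [Pi.sub_apply] at this
        calc w i l - (z l - δ) = (w i l - z l) + δ := by abel
          _ ≤ (w i l - z l) + (w i k - z k - (w i l - z l)) := by gcongr
          _ = w i k - z k := by abel
      · rw [hz'N k hk, hz'R l hl]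
        calc w i l - z l ≤ w i k - z k := h1
          _ ≤ w i k - (z k - δ) := sub_le_sub_left (sub_le_self _ hδ0) _
      · rw [hz'N k hk, hz'N l hl]
        calc w i l - (z l - δ) = (w i l - z l) + δ := by abel
          _ ≤ (w i k - z k) + δ := by gcongr
          _ = w i k - (z k - δ) := by abel
    have hmono : ∀ g, R z g → R z' g := by
      rintro g ⟨o, ho, hog⟩
      refine ⟨o, ho, ?_⟩
      induction hog with
      | refl => exact .refl
      | @tail k l hok hkl ih' =>
        refine ih'.tail ?_
        obtain ⟨i, hi⟩ := hkl
        have hk : R z k := ⟨o, ho, hok⟩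
        have hl : R z l := ⟨o, ho, hok.tail ⟨i, hi⟩⟩
        refine ⟨i, (exchange_mem_argmaxOn (hx' i)).2 ?_⟩
        have := (exchange_mem_argmaxOn (hx i)).1 hi
        simpa [hz'R _ hk, hz'R _ hl] using this
    have hnew : R z' l₀ := by
      obtain ⟨o, ho, hok⟩ := hmono k₀ hk₀
      refine ⟨o, ho, hok.tail ⟨i₀, (exchange_mem_argmaxOn (hx' i₀)).2 ⟨hB₀, ?_⟩⟩⟩
      simp only [Pi.sub_apply] at hδ ⊢
      rw [hz'R _ hk₀, hz'N _ hl₀, hδ]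
      abel
    have hcard : #{g | ¬ R z' g} < n := by
      rw [← hn]
      refine card_lt_card (ssubset_iff_of_subset ?_ |>.2 ⟨l₀, ?_, ?_⟩)
      · intro g
        simp only [mem_filter, mem_univ, true_and]
        exact fun h h' => h (hmono g h')
      · simpa using hl₀
      · simpa using hnew
    obtain ⟨z'', h1, h2, h3, h4⟩ := ih _ hcard z' hx' rfl
    exact ⟨z'', h1.trans hz', fun g hg => (h2 g hg).trans (hz'R g (hRO g hg)), h3, h4⟩

end Reach

end DiscreteConvex

namespace DiscreteConvex

/-! ### Free disposal encoded by used and unused units. -/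

section Split

variable {M : Type*} [Fintype M] [DecidableEq M]

/-- Integer copies of a set of bundles. -/
def toInt (B : Set (M → ℕ)) : Set (M → ℤ) := (fun b j => (b j : ℤ)) '' B

/-- Bundles whose units are divided into used units `inl j` and unused units `inr j`. -/
def split (B : Set (M → ℤ)) : Set (M ⊕ M → ℤ) :=
  {v | 0 ≤ v ∧ (fun j => v (.inl j) + v (.inr j)) ∈ B}

theorem total_exchange (v : M ⊕ M → ℤ) (g h : M ⊕ M) :
    (fun j => (v - Pi.single g 1 + Pi.single h 1 : M ⊕ M → ℤ) (.inl j) +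
      (v - Pi.single g 1 + Pi.single h 1 : M ⊕ M → ℤ) (.inr j)) =
    (fun j => v (.inl j) + v (.inr j)) - Pi.single (Sum.elim id id g) 1
      + Pi.single (Sum.elim id id h) 1 := by
  ext j
  rcases g with g | g <;> rcases h with h | h <;>
    simp only [Pi.add_apply, Pi.sub_apply, Pi.single_apply, Sum.inl.injEq, Sum.inr.injEq,
      reduceCtorEq, if_false, Sum.elim_inl, Sum.elim_inr, id] <;> ring

theorem exchange_nonneg {v : M ⊕ M → ℤ} (hv : 0 ≤ v) {g h : M ⊕ M} (hg : 0 < v g) :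
    0 ≤ v - Pi.single g 1 + Pi.single h 1 := by
  intro a
  have := hv a
  simp only [Pi.zero_apply, Pi.add_apply, Pi.sub_apply, Pi.single_apply] at this ⊢
  split_ifs with h1 <;> (try subst h1) <;> omega

theorem MConvex.split {B : Set (M → ℤ)} (hB : MConvex B) : MConvex (split B) := by
  rintro v ⟨hv0, hv⟩ v' ⟨hv'0, hv'⟩ g hg
  have swap : ∀ h, v' + Pi.single g 1 - Pi.single h 1 = v' - Pi.single h 1 + Pi.single g 1 :=
    fun h => by abel
  -- Either the other kind of unit of the same good compensates, leaving the total bundle unchanged,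
  -- or the totals of this good differ and the exchange is made in `B`.
  by_cases hf : ∃ h, Sum.elim id id h = Sum.elim id id g ∧ v h < v' h
  · obtain ⟨h, hbase, hlt⟩ := hf
    refine ⟨h, hlt, ⟨exchange_nonneg hv0 ((hv'0 g).trans_lt hg), ?_⟩, ?_⟩
    · rw [total_exchange, hbase]; simpa using hv
    · rw [swap]
      refine ⟨exchange_nonneg hv'0 ((hv0 h).trans_lt hlt), ?_⟩
      rw [total_exchange, hbase]; simpa using hv'
  · push Not at hf
    obtain ⟨k, hk, h1, h2⟩ := hB _ hv _ hv' (Sum.elim id id g) (by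
      rcases g with j | j
      · have := hf (.inr j) rfl
        simp only [Sum.elim_inl, id]; omega
      · have := hf (.inl j) rfl
        simp only [Sum.elim_inr, id]; omega)
    obtain ⟨h, rfl, hlt⟩ : ∃ h : M ⊕ M, Sum.elim id id h = k ∧ v h < v' h := by
      by_contra! hne
      have h1 := hne (.inl k) rfl
      have h2 := hne (.inr k) rfl
      omega
    refine ⟨h, hlt, ⟨exchange_nonneg hv0 ((hv'0 g).trans_lt hg), ?_⟩, ?_⟩
    · rw [total_exchange]; exact h1
    · rw [swap]
      refine ⟨exchange_nonneg hv'0 ((hv0 h).trans_lt hlt), ?_⟩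
      rw [total_exchange]; convert h2 using 1; abel

/-- Vectors of unsold units `inl j`, balanced by the unused units. -/
def unsold (M : Type*) [Fintype M] : Set (M ⊕ M → ℤ) :=
  {v | (∀ j, 0 ≤ v (.inl j)) ∧ ∑ g, v g = 0}

theorem exchange_mem_unsold {v : M ⊕ M → ℤ} (hv : v ∈ unsold M) {g h : M ⊕ M}
    (hg : ∀ j, g = .inl j → 0 < v g) : v - Pi.single g 1 + Pi.single h 1 ∈ unsold M := by
  refine ⟨fun j => ?_, ?_⟩
  · have h1 := hv.1 j
    have h2 := hg j
    simp only [Pi.add_apply, Pi.sub_apply, Pi.single_apply]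
    split_ifs with a b b <;> first | omega | (have := h2 a.symm; subst a; omega)
  · simp only [Pi.add_apply, Pi.sub_apply, sum_add_distrib, sum_sub_distrib, hv.2,
      sum_pi_single', mem_univ, if_true]
    ring

theorem mConvex_unsold : MConvex (unsold M) := by
  intro v hv v' hv' g hg
  obtain ⟨h, hh⟩ : ∃ h, v h < v' h := by
    by_contra! hle
    have := sum_lt_sum (fun a _ => hle a) ⟨g, mem_univ g, hg⟩
    rw [hv.2, hv'.2] at this
    exact lt_irrefl _ this
  refine ⟨h, hh, exchange_mem_unsold hv fun j hj => ?_, ?_⟩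
  · subst hj; exact (hv'.1 j).trans_lt hg
  · rw [show v' + Pi.single g 1 - Pi.single h 1 = v' - Pi.single h 1 + Pi.single g 1 by abel]
    refine exchange_mem_unsold hv' fun j hj => ?_
    subst hj; exact (hv.1 j).trans_lt hh

end Split

/-! ### Existence of competitive prices that survive an extra unit of supply. -/

section Market

variable {N M V : Type*} [Fintype N] [Fintype M] [DecidableEq M]
  [AddCommGroup V] [LinearOrder V] [IsOrderedAddMonoid V]

/-- The worth of the bundle `y` when `j` is worth `c j` per unit. -/
def bundleValue (c : M → V) (y : M → ℕ) : V := ∑ j, y j • c j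

/-- At prices `z` and supply `s`, the bundles `x i` maximize the surplus of the buyers among the
parts of bundles in `B i`, and unsold goods are free. -/
structure IsCompetitive (B : N → Set (M → ℕ)) (w : N → M → V) (s : M → ℕ) (z : M → V)
    (x : N → M → ℕ) : Prop where
  mem : ∀ i, x i ∈ lowerClosure (B i)
  opt : ∀ i, ∀ y ∈ lowerClosure (B i), bundleValue (w i - z) y ≤ bundleValue (w i - z) (x i)
  nonneg : 0 ≤ z
  feasible : ∀ j, ∑ i, x i j ≤ s j
  slack : ∀ j, ∑ i, x i j < s j → z j = 0

/-- The buyers, and an agent `none` who holds the unsold units. -/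
def agentSet (B : N → Set (M → ℕ)) : Option N → Set (M ⊕ M → ℤ)
  | none => unsold M
  | some i => split (toInt (B i))

/-- Weights of the agents; unused and unsold units are worthless. -/
def agentWeight (w : N → M → V) : Option N → M ⊕ M → V
  | none => 0
  | some i => Sum.elim (w i) 0

/-- Demand sets of the agents. -/
def agentDemand (B : N → Set (M → ℕ)) (w : N → M → V) (z : M → V) (a : Option N) :
    Set (M ⊕ M → ℤ) :=
  argmaxOn (agentSet B a) (agentWeight w a - Sum.elim z 0)

/-- Balanced agent bundles that are demanded at prices `z`. -/
structure IsSupported (B : N → Set (M → ℕ)) (w : N → M → V) (s : M → ℕ) (z : M → V)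
    (v : Option N → M ⊕ M → ℤ) : Prop where
  opt : ∀ a, v a ∈ agentDemand B w z a
  sum : ∀ j, ∑ a, v a (.inl j) = s j

variable {B : N → Set (M → ℕ)} {w : N → M → V} {s : M → ℕ} {z : M → V}

theorem mConvex_agentSet (hB : ∀ i, MConvex (toInt (B i))) : ∀ a, MConvex (agentSet B a)
  | none => mConvex_unsold
  | some i => (hB i).split

theorem pairing_agent_some (i : N) (v : M ⊕ M → ℤ) :
    pairing (agentWeight w (some i) - Sum.elim z 0) v = ∑ j, v (.inl j) • (w i j - z j) := by
  simp [pairing_apply, agentWeight]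

theorem pairing_agent_none (v : M ⊕ M → ℤ) :
    pairing (agentWeight w none - Sum.elim z 0) v = - ∑ j, v (.inl j) • z j := by
  simp [pairing_apply, agentWeight]

theorem mem_lowerClosure_of_split {i : N} {v : M ⊕ M → ℤ} (hv : v ∈ split (toInt (B i))) :
    (fun j => (v (.inl j)).toNat) ∈ lowerClosure (B i) := by
  obtain ⟨hv0, b, hb, hbv⟩ := hv
  refine mem_lowerClosure.2 ⟨b, hb, fun j => ?_⟩
  have h1 := congrFun hbv j
  have h2 := hv0 (.inr j)
  simp only [Pi.zero_apply] at h1 h2 ⊢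
  omega

theorem value_toNat {c : M → V} {v : M ⊕ M → ℤ} (hv : 0 ≤ v) :
    bundleValue c (fun j => (v (.inl j)).toNat) = ∑ j, v (.inl j) • c j := by
  refine sum_congr rfl fun j _ => ?_
  conv_rhs => rw [← Int.toNat_of_nonneg (hv (.inl j)), natCast_zsmul]

/-- The conditions on prices come from the agent `none`: turning `inr j` into `inl j` is always
possible for it, which forces `0 ≤ z j`; the reverse is possible when `j` is unsold, which forces `z
j ≤ 0`. -/
theorem IsSupported.isCompetitive (hB : ∀ i, MConvex (toInt (B i))) {v : Option N → M ⊕ M → ℤ}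
    (h : IsSupported B w s z v) :
    IsCompetitive B w s z fun i j => (v (some i) (.inl j)).toNat := by
  have hnn : ∀ i, 0 ≤ v (some i) := fun i => (h.opt (some i)).1.1
  have hU : v none ∈ unsold M := (h.opt none).1
  have hloc := (mem_argmaxOn_iff (mConvex_agentSet hB none) (h.opt none).1).1 (h.opt none)
  have hz : 0 ≤ z := by
    intro j
    have := hloc (.inr j) (.inl j) (exchange_mem_unsold hU (by simp))
    simpa [agentWeight] using this
  have hsum : ∀ j, v none (.inl j) + ((∑ i, (v (some i) (.inl j)).toNat : ℕ) : ℤ) = s j := by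
    intro j
    rw [← h.sum j, Fintype.sum_option]
    push_cast
    congr 1
    exact sum_congr rfl fun i _ => Int.toNat_of_nonneg (hnn i _)
  refine ⟨fun i => mem_lowerClosure_of_split (h.opt (some i)).1, fun i y hy => ?_, hz,
    fun j => ?_, fun j hj => ?_⟩
  · obtain ⟨b, hb, hyb⟩ := mem_lowerClosure.1 hy
    have := (h.opt (some i)).2 (Sum.elim (fun j => (y j : ℤ)) fun j => (b j : ℤ) - y j) ⟨?_, b, hb, ?_⟩
    · rw [pairing_agent_some, pairing_agent_some] at this
      rw [value_toNat (hnn i)]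
      simpa [bundleValue] using this
    · rintro (j | j)
      · simp
      · simpa using hyb j
    · ext j; simp
  · have := hsum j
    have := hU.1 j
    omega
  · have h1 := hsum j
    have h2 := hloc (.inl j) (.inr j) (exchange_mem_unsold hU (by
      intro _ _
      omega))
    refine le_antisymm ?_ (hz j)
    simpa [agentWeight] using h2

theorem IsCompetitive.exists_isSupported {x b : N → M → ℕ}
    (h : IsCompetitive B w s z x) (hb : ∀ i, b i ∈ B i) (hxb : ∀ i, x i ≤ b i) :
    IsSupported B w s z fun a => a.elim
      (Sum.elim (fun j => (s j : ℤ) - ∑ i, x i j) fun j => -((s j : ℤ) - ∑ i, x i j))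
      fun i => Sum.elim (fun j => (x i j : ℤ)) fun j => (b i j : ℤ) - x i j := by
  have hfeas : ∀ j, (0 : ℤ) ≤ (s j : ℤ) - ∑ i, x i j := fun j => by
    have := h.feasible j
    rw [sub_nonneg]
    exact_mod_cast this
  constructor
  · rintro (_ | i)
    · refine ⟨⟨by simpa using hfeas, by simp⟩, fun v hv => ?_⟩
      rw [pairing_agent_none, pairing_agent_none, neg_le_neg_iff]
      refine (sum_eq_zero fun j _ => ?_).trans_le
        (sum_nonneg fun j _ => zsmul_nonneg (h.nonneg j) (hv.1 j))
      rcases (h.feasible j).lt_or_eq with hlt | heq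
      · simp [h.slack j hlt]
      · simp [← heq]
    · refine ⟨⟨?_, b i, hb i, ?_⟩, fun v hv => ?_⟩
      · rintro (j | j)
        · simp
        · simpa using hxb i j
      · ext j; simp
      · rw [pairing_agent_some, pairing_agent_some]
        have := h.opt i _ (mem_lowerClosure_of_split hv)
        rw [value_toNat hv.1] at this
        simpa [bundleValue] using this
  · intro j
    simp [Fintype.sum_option]

/-- The worthless goods `inr` serve as sources, which keeps their prices at 0. The agent `none` can
swap `inr j` for `inl j` without bound, so an exchange always leads out of the sources. -/
theorem IsSupported.exists_reachable (hB : ∀ i, MConvex (toInt (B i)))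
    {v : Option N → M ⊕ M → ℤ} (h : IsSupported B w s z v) :
    ∃ z' ≤ z, IsSupported B w s z' v ∧
      ∀ j, ∃ k, Relation.ReflTransGen (Swap (agentDemand B w z') v) (.inr k) (.inl j) := by
  obtain ⟨z', hz', hO, hopt, hreach⟩ := DiscreteConvex.exists_reachable (mConvex_agentSet hB)
    (agentWeight w) (Set.range Sum.inr) (x := v) (by
      rintro (j | j) hj
      · exact ⟨.inr j, ⟨j, rfl⟩, none, exchange_mem_unsold (h.opt none).1 (by simp)⟩
      · exact absurd ⟨j, rfl⟩ hj) (Sum.elim z 0) h.opt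
  have hz'' : z' = Sum.elim (fun j => z' (.inl j)) 0 := by
    ext (j | j)
    · rfl
    · exact hO _ ⟨j, rfl⟩
  rw [hz''] at hopt hreach
  refine ⟨fun j => z' (.inl j), fun j => hz' (.inl j), ⟨hopt, h.sum⟩, fun j => ?_⟩
  obtain ⟨_, ⟨k, rfl⟩, hk⟩ := hreach (.inl j)
  exact ⟨k, hk⟩

/-- Only the totals at `inl` are prescribed, so a path that starts at `inr k` costs no supply and
adds a unit of `j`. -/
theorem IsSupported.exists_augment (hB : ∀ i, MConvex (toInt (B i)))
    {v : Option N → M ⊕ M → ℤ} (h : IsSupported B w s z v) {j k : M}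
    (hr : Relation.ReflTransGen (Swap (agentDemand B w z) v) (.inr k) (.inl j)) :
    ∃ v', IsSupported B w (s + Pi.single j 1) z v' := by
  obtain ⟨v', hv', hsum⟩ := DiscreteConvex.exists_augment
    (fun a => (mConvex_agentSet hB a).argmaxOn _) h.opt hr
  refine ⟨v', hv', fun l => ?_⟩
  have := congrFun hsum (.inl l)
  rw [Finset.sum_apply, Pi.add_apply, Pi.sub_apply, Finset.sum_apply, h.sum l] at this
  rw [this]
  simp [Pi.single_apply]

theorem exists_isSupported (hB : ∀ i, MConvex (toInt (B i))) (hne : ∀ i, (B i).Nonempty)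
    (w : N → M → V) (s : M → ℕ) : ∃ z v, IsSupported B w s z v := by
  induction hn : ∑ j, s j generalizing s with
  | zero =>
    have hs : s = 0 := by
      ext j
      exact (sum_eq_zero_iff.1 hn) j (mem_univ j)
    subst hs
    choose b hb using hne
    -- With no supply, take prices so high that the empty bundle is optimal for everyone.
    have hz : ∀ i j, w i j ≤ ∑ i, |w i j| := fun i j => (le_abs_self _).trans
      (single_le_sum (f := fun i => |w i j|) (fun i _ => abs_nonneg _) (mem_univ i))
    have : IsCompetitive B w 0 (fun j => ∑ i, |w i j|) (fun _ _ => 0) := by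
      refine ⟨fun i => mem_lowerClosure.2 ⟨b i, hb i, fun j => Nat.zero_le _⟩, fun i y _ => ?_,
        fun j => sum_nonneg fun i _ => abs_nonneg _, by simp, by simp⟩
      refine (sum_nonpos fun j _ => ?_).trans_eq (by simp [bundleValue])
      exact nsmul_nonpos (sub_nonpos.2 (hz i j)) _
    exact ⟨_, _, this.exists_isSupported hb fun i j => Nat.zero_le _⟩
  | succ n ih =>
    obtain ⟨j, hj⟩ : ∃ j, s j ≠ 0 := by
      by_contra! h
      simp [h] at hn
    have hs : s - Pi.single j 1 + Pi.single j 1 = s := by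
      ext l
      by_cases hl : l = j
      · subst hl; simp; omega
      · simp [hl]
    -- Remove one unit of `j`, support the rest, and put the unit back along a path.
    obtain ⟨z, v, h⟩ := ih (s - Pi.single j 1) (by
      have : ∑ l, s l = ∑ l, (s - Pi.single j 1 : M → ℕ) l + 1 := by
        conv_lhs => rw [← hs]
        simp only [Pi.add_apply, sum_add_distrib, sum_pi_single', mem_univ, if_true]
      omega)
    obtain ⟨z', -, h', hr⟩ := h.exists_reachable hB
    obtain ⟨k, hk⟩ := hr j
    obtain ⟨v', hv'⟩ := h'.exists_augment hB hk
    rw [hs] at hv'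
    exact ⟨z', v', hv'⟩

/-- Competitive prices that stay competitive when the supply of any one good grows by one unit. -/
theorem exists_isCompetitive (hB : ∀ i, MConvex (toInt (B i))) (hne : ∀ i, (B i).Nonempty)
    (w : N → M → V) (s : M → ℕ) :
    ∃ z, (∃ x, IsCompetitive B w s z x) ∧
      ∀ j, ∃ x, IsCompetitive B w (s + Pi.single j 1) z x := by
  obtain ⟨z, v, h⟩ := exists_isSupported hB hne w s
  obtain ⟨z', -, h', hr⟩ := h.exists_reachable hB
  refine ⟨z', ⟨_, h'.isCompetitive hB⟩, fun j => ?_⟩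
  obtain ⟨k, hk⟩ := hr j
  obtain ⟨v', hv'⟩ := h'.exists_augment hB hk
  exact ⟨_, hv'.isCompetitive hB⟩

/-- At the least competitive prices for `x`, a buyer who holds a single unit can be removed, and
the unit can be sold to the others. -/
theorem IsCompetitive.exists_without [DecidableEq N] (hB : ∀ i, MConvex (toInt (B i)))
    {x : N → M → ℕ} (h : IsCompetitive B w s z x)
    (hmin : ∀ z' ≤ z, IsCompetitive B w s z' x → z ≤ z')
    {k : N} {j : M} (hk : x k = Pi.single j 1) (hkB : x k ∈ B k) :
    ∃ x', IsCompetitive (fun i : {i // i ≠ k} => B i) (fun i => w i) s z x' := by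
  have hb : ∀ i, ∃ b ∈ B i, x i ≤ b ∧ (i = k → b = x k) := by
    intro i
    by_cases hi : i = k
    · subst hi; exact ⟨x i, hkB, le_rfl, fun _ => rfl⟩
    · obtain ⟨b, hb, hxb⟩ := mem_lowerClosure.1 (h.mem i)
      exact ⟨b, hb, hxb, fun hik => absurd hik hi⟩
  choose b hbB hxb hbk using hb
  have hv := h.exists_isSupported hbB hxb
  obtain ⟨z', hz', hv', hreach⟩ := hv.exists_reachable hB
  have hzz : z' = z := by
    refine le_antisymm hz' (hmin z' hz' ?_)
    simpa using hv'.isCompetitive hB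
  subst hzz
  set v : Option N → M ⊕ M → ℤ := fun a => a.elim
      (Sum.elim (fun j => (s j : ℤ) - ∑ i, x i j) fun j => -((s j : ℤ) - ∑ i, x i j))
      fun i => Sum.elim (fun j => (x i j : ℤ)) fun j => (b i j : ℤ) - x i j with hvdef
  have hvk : v (some k) = Pi.single (.inl j) 1 := by
    ext (l | l)
    · simp [hvdef, hk, Pi.single_apply]
    · simp [hvdef, hbk k rfl]
  have hsj : 1 ≤ s j := by
    refine le_trans ?_ ((single_le_sum (f := fun i => x i j) (fun i _ => Nat.zero_le _)
      (mem_univ k)).trans (h.feasible j))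
    simp [hk]
  let v₁ : Option {i // i ≠ k} → M ⊕ M → ℤ := fun a => v (a.map Subtype.val)
  have hD : ∀ a, agentDemand (fun i : {i // i ≠ k} => B i) (fun i => w i) z' a =
      agentDemand B w z' (a.map Subtype.val) := by
    rintro (_ | i) <;> rfl
  have h₁ : IsSupported (fun i : {i // i ≠ k} => B i) (fun i => w i) (s - Pi.single j 1) z' v₁ := by
    refine ⟨fun a => ?_, fun l => ?_⟩
    · rw [hD]; exact hv'.opt _
    · have := hv'.sum l
      rw [Fintype.sum_option, Fintype.sum_eq_add_sum_subtype_ne _ k, hvk] at this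
      rw [Fintype.sum_option]
      simp only [v₁, Option.map_none, Option.map_some]
      by_cases hl : l = j
      · subst hl
        simp at this ⊢
        omega
      · simp [hl] at this ⊢
        omega
  obtain ⟨o, ho⟩ := hreach j
  -- A nontrivial swap by `k` can only start at `inl j`. So the path has already arrived at `inl j`
  -- before `k` is needed, and the part up to there uses the other agents only.
  have hor : ∀ g, Relation.ReflTransGen (Swap (agentDemand B w z') v) (.inr o) g →
      Relation.ReflTransGen (Swap (agentDemand (fun i : {i // i ≠ k} => B i) (fun i => w i) z') v₁)
        (.inr o) g ∨
      Relation.ReflTransGen (Swap (agentDemand (fun i : {i // i ≠ k} => B i) (fun i => w i) z') v₁)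
        (.inr o) (.inl j) := by
    intro g hg
    induction hg with
    | refl => exact .inl .refl
    | @tail c d _ hcd ih =>
      rcases ih with ih | ih
      swap
      · exact .inr ih
      obtain ⟨a, ha⟩ := hcd
      by_cases hak : a = some k
      · subst hak
        rw [hvk] at ha
        by_cases hc : c = .inl j
        · subst hc; exact .inr ih
        · by_cases hdc : c = d
          · subst hdc; exact .inl ih
          · have := ha.1.1 c
            simp [hc, hdc] at this
      · refine .inl (ih.tail ?_)
        rcases a with _ | i
        · exact ⟨none, by rw [hD]; exact ha⟩
        · have hik : i ≠ k := fun h => hak (by rw [h])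
          exact ⟨some ⟨i, hik⟩, by rw [hD]; exact ha⟩
  have hr := (hor _ ho).elim id id
  have hB' : ∀ i : {i // i ≠ k}, MConvex (toInt (B i)) := fun i => hB i
  obtain ⟨v', hv'⟩ := h₁.exists_augment hB' hr
  have hs : s - Pi.single j 1 + Pi.single j 1 = s := by
    ext l
    by_cases hl : l = j
    · subst hl; simp; omega
    · simp [hl]
  rw [hs] at hv'
  exact ⟨_, hv'.isCompetitive hB'⟩

end Market

end DiscreteConvex

namespace DiscreteConvex

/-! ### Polymatroids spanned by M-convex sets, and contraction. -/

section Polymatroid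

variable {M : Type*} [Fintype M] [DecidableEq M]

/-- The rank function of a finite set of bundles. -/
def rankOf (B : Finset (M → ℕ)) (S : Finset M) : ℕ := B.sup fun x => ∑ j ∈ S, x j

/-- Indicator weights. -/
def indicator (S : Finset M) (j : M) : ℤ := if j ∈ S then 1 else 0

theorem pairing_indicator (S : Finset M) (b : M → ℕ) :
    pairing (indicator S) (fun j => (b j : ℤ)) = ((∑ j ∈ S, b j : ℕ) : ℤ) := by
  simp [pairing_apply, indicator, sum_ite_mem]

theorem sum_le_rankOf {B : Finset (M → ℕ)} {b : M → ℕ} (hb : b ∈ B) (S : Finset M) :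
    ∑ j ∈ S, b j ≤ rankOf B S := le_sup (f := fun x : M → ℕ => ∑ j ∈ S, x j) hb

theorem sum_eq_rankOf_of_local {B : Finset (M → ℕ)} (hB : MConvex (toInt (B : Set (M → ℕ))))
    {b : M → ℕ} (hb : b ∈ B) {S : Finset M}
    (h : ∀ k l, (fun j => (b j : ℤ)) - Pi.single k 1 + Pi.single l 1 ∈ toInt (B : Set (M → ℕ)) →
      l ∈ S → k ∈ S) : ∑ j ∈ S, b j = rankOf B S := by
  refine le_antisymm (sum_le_rankOf hb S) (Finset.sup_le fun y hy => ?_)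
  have := hB.le_of_local (c := indicator S) ⟨b, hb, rfl⟩ (fun k l hkl => ?_) ⟨y, hy, rfl⟩
  · rw [pairing_indicator, pairing_indicator] at this
    exact_mod_cast this
  · have := h k l hkl
    simp only [indicator]
    split_ifs <;> simp_all

/-- Greedy principle: with weight 2 on `S`, 1 on the rest of `T` and 0 elsewhere, no swap at a
maximizer leads into `S` or into `T` from outside. This plays the role of submodularity. -/
theorem exists_sum_eq_rankOf {B : Finset (M → ℕ)} (hB : MConvex (toInt (B : Set (M → ℕ))))
    (hne : B.Nonempty) {S T : Finset M} (hST : S ⊆ T) :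
    ∃ b ∈ B, ∑ j ∈ S, b j = rankOf B S ∧ ∑ j ∈ T, b j = rankOf B T := by
  obtain ⟨b, hb, hmax⟩ := B.exists_max_image
    (fun b => pairing (indicator S + indicator T) fun j => (b j : ℤ)) hne
  have hloc := (mem_argmaxOn_iff hB (c := indicator S + indicator T) ⟨b, hb, rfl⟩).1
    ⟨⟨b, hb, rfl⟩, by rintro _ ⟨y, hy, rfl⟩; exact hmax y hy⟩
  refine ⟨b, hb, sum_eq_rankOf_of_local hB hb fun k l hkl hl => ?_,
    sum_eq_rankOf_of_local hB hb fun k l hkl hl => ?_⟩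
  · by_contra hk
    have := hloc k l hkl
    simp only [Pi.add_apply, indicator, hl, hk, hST hl, if_true, if_false] at this
    split_ifs at this <;> omega
  · by_contra hk
    have hkS : k ∉ S := fun h => hk (hST h)
    have := hloc k l hkl
    simp only [Pi.add_apply, indicator, hl, hk, hkS, if_true, if_false] at this
    split_ifs at this <;> omega

theorem mem_polymatroid_rankOf {B : Finset (M → ℕ)} (hB : MConvex (toInt (B : Set (M → ℕ))))
    (hne : B.Nonempty) {x : M → ℕ} :
    x ∈ polymatroid (rankOf B) ↔ x ∈ lowerClosure (B : Set (M → ℕ)) := by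
  rw [mem_polymatroid, mem_lowerClosure]
  constructor
  swap
  · rintro ⟨b, hb, hxb⟩ S
    exact (sum_le_sum fun j _ => hxb j).trans (sum_le_rankOf hb S)
  intro hx
  obtain ⟨b, hb, hmin⟩ := B.exists_min_image (fun b => ∑ j, (x j - b j)) hne
  refine ⟨b, hb, ?_⟩
  by_contra hxb
  obtain ⟨j₀, hj₀⟩ : ∃ j, b j < x j := by
    by_contra! h
    exact hxb h
  classical
  -- `b` has the least total deficit against `x`; `T` collects the goods that can give a unit to a
  -- deficient good. By minimality `b ≤ x` on `T`, and by transitivity of exchanges no swap enters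
  -- `T`. So `b` attains the rank of `T`, while `x` has strictly more there.
  let T : Finset M := univ.filter fun k => ∃ j, b j < x j ∧
    (fun j => (b j : ℤ)) - Pi.single k 1 + Pi.single j 1 ∈ toInt (B : Set (M → ℕ))
  have hT : ∀ j, b j < x j → j ∈ T := fun j hj =>
    mem_filter.2 ⟨mem_univ _, j, hj, by simpa using ⟨b, hb, rfl⟩⟩
  have hle : ∀ k ∈ T, b k ≤ x k := by
    intro k hk
    obtain ⟨-, j, hj, b', hb', hbb⟩ := mem_filter.1 hk
    by_contra! hlt
    have hkj : k ≠ j := by rintro rfl; omega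
    refine absurd (hmin b' hb') (not_le.2 (sum_lt_sum (fun l _ => ?_) ⟨j, mem_univ j, ?_⟩))
    · have := congrFun hbb l
      simp only [Pi.add_apply, Pi.sub_apply, Pi.single_apply] at this
      split_ifs at this with h1 h2 h2 <;> (try subst h1) <;> (try subst h2) <;> omega
    · have := congrFun hbb j
      simp [hkj.symm] at this
      omega
  have hrank := sum_eq_rankOf_of_local hB hb (S := T) fun k l hkl hl => by
    obtain ⟨-, j, hj, hjl⟩ := mem_filter.1 hl
    exact mem_filter.2 ⟨mem_univ _, j, hj, hB.exchange_trans ⟨b, hb, rfl⟩ hjl hkl⟩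
  have := sum_lt_sum hle ⟨j₀, hT j₀ hj₀, hj₀⟩
  have := hx T
  omega

theorem sum_extend {X : Finset M} (x : M → ℕ) (y : {j // j ∈ X} → ℕ) (S : Finset M) :
    ∑ j ∈ S, (if h : j ∈ X then y ⟨j, h⟩ else x j) =
      ∑ j ∈ S.subtype (· ∈ X), y j + ∑ j ∈ S.filter (· ∉ X), x j := by
  rw [← sum_filter_add_sum_filter_not S (· ∈ X)]
  congr 1
  · rw [← subtype_map, sum_map]
    exact sum_congr rfl fun j _ => by simp
  · exact sum_congr rfl fun j hj => by simp [(mem_filter.1 hj).2]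

/-- A single bundle `b` tight on the nested sets `S \ X` and `(S ∩ X) ∪ Xᶜ` bounds both parts of the
sum, and `b` itself obeys the bound on `S`. -/
theorem extend_mem_polymatroid {B : Finset (M → ℕ)} (hB : MConvex (toInt (B : Set (M → ℕ))))
    (hne : B.Nonempty) {X : Finset M} {x : M → ℕ} (hx : x ∈ polymatroid (rankOf B))
    {y : {j // j ∈ X} → ℕ} (hy : y ∈ polymatroid (contractOnto (rankOf B) X)) :
    (fun j => if h : j ∈ X then y ⟨j, h⟩ else x j) ∈ polymatroid (rankOf B) := by
  rw [mem_polymatroid] at *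
  intro S
  rw [sum_extend]
  have h1 := hy (S.subtype (· ∈ X))
  have h2 := hx (S.filter (· ∉ X))
  rw [contractOnto, subtype_map] at h1
  have hsub : S.filter (· ∉ X) ⊆ S.filter (· ∈ X) ∪ Xᶜ := fun j hj =>
    mem_union_right _ (mem_compl.2 (mem_filter.1 hj).2)
  obtain ⟨b, hb, e1, e2⟩ := exists_sum_eq_rankOf hB hne hsub
  have h3 : ∑ j ∈ S.filter (· ∈ X) ∪ Xᶜ, b j = ∑ j ∈ S.filter (· ∈ X), b j + ∑ j ∈ Xᶜ, b j :=
    sum_union (disjoint_left.2 fun j hj hj' => mem_compl.1 hj' (mem_filter.1 hj).2)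
  have h4 := sum_filter_add_sum_filter_not S (· ∈ X) b
  have h5 := sum_le_rankOf hb S
  have h6 := sum_le_rankOf hb Xᶜ
  omega

theorem restrict_mem_polymatroid {ρ : Finset M → ℕ} {X : Finset M} {x : M → ℕ}
    (hx : x ∈ polymatroid ρ) (hX : ∑ j ∈ Xᶜ, x j = ρ Xᶜ) :
    (fun j : {j // j ∈ X} => x j) ∈ polymatroid (contractOnto ρ X) := by
  rw [mem_polymatroid] at *
  intro S
  have := hx (S.map (Function.Embedding.subtype _) ∪ Xᶜ)
  rw [sum_union, sum_map] at this
  · simp only [Function.Embedding.subtype_apply] at this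
    rw [contractOnto]
    omega
  · rw [disjoint_left]
    intro j hj
    obtain ⟨j, -, rfl⟩ := mem_map.1 hj
    simp

end Polymatroid

end DiscreteConvex

/-! ### Minimal demand sets and the over-demand function. -/

namespace Market

open DiscreteConvex

variable {N M : Type*} [Fintype N] [Fintype M] [DecidableEq M] (E : Market N M) (p : M → ℝ)

variable {E p} {i : N}

theorem mem_demand {x : M → ℕ} :
    x ∈ E.demand p i ↔ x ≤ E.supply ∧ ∀ y ≤ E.supply, E.util p i y ≤ E.util p i x := by
  simp [demand]

theorem mem_minDemand {x : M → ℕ} :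
    x ∈ E.minDemand p i ↔ x ∈ E.demand p i ∧ ∀ y ∈ E.demand p i, y ≤ x → y = x := by
  simp [minDemand]

variable (E p i)

theorem demand_nonempty : (E.demand p i).Nonempty := by
  obtain ⟨x, hx, hmax⟩ := (Iic E.supply).exists_max_image (E.util p i) ⟨0, by simp⟩
  exact ⟨x, mem_demand.2 ⟨mem_Iic.1 hx, fun y hy => hmax y (mem_Iic.2 hy)⟩⟩

variable {E p i}

/-- At fixed prices the payments are linear in the bundle, so only the valuations matter; two
utilities bounded by the maximum whose sum is at least twice the maximum both attain it. -/
theorem mem_demand_of_add_eq {x x' a a' : M → ℕ} (hx : x ∈ E.demand p i) (hx' : x' ∈ E.demand p i)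
    (ha : a ≤ E.supply) (ha' : a' ≤ E.supply) (hsum : a + a' = x + x')
    (hval : E.val i x + E.val i x' ≤ E.val i a + E.val i a') :
    a ∈ E.demand p i ∧ a' ∈ E.demand p i := by
  rw [mem_demand] at hx hx'
  rw [mem_demand, mem_demand]
  have hlin : ∑ j, E.pay i j (p j) * (a j : ℝ) + ∑ j, E.pay i j (p j) * (a' j : ℝ) =
      ∑ j, E.pay i j (p j) * (x j : ℝ) + ∑ j, E.pay i j (p j) * (x' j : ℝ) := by
    rw [← sum_add_distrib, ← sum_add_distrib]
    refine sum_congr rfl fun j _ => ?_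
    have : (a j : ℝ) + a' j = x j + x' j := by exact_mod_cast congrFun hsum j
    rw [← mul_add, ← mul_add, this]
  have h1 := hx.2 a ha
  have h2 := hx'.2 a' ha'
  have e : ∀ y, E.util p i y = E.val i y - ∑ j, E.pay i j (p j) * (y j : ℝ) := fun _ => rfl
  refine ⟨⟨ha, fun y hy => (hx.2 y hy).trans ?_⟩, ha', fun y hy => (hx'.2 y hy).trans ?_⟩ <;>
  · simp only [e] at *
    linarith

theorem exchange_demand {x x' : M → ℕ} (hx : x ∈ E.demand p i) (hx' : x' ∈ E.demand p i) {j : M}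
    (hj : x' j < x j) : x - Pi.single j 1 ∈ E.demand p i ∨ ∃ k, x k < x' k ∧
      x - Pi.single j 1 + Pi.single k 1 ∈ E.demand p i ∧
      x' + Pi.single j 1 - Pi.single k 1 ∈ E.demand p i := by
  have hxs := (mem_demand.1 hx).1
  have hxs' := (mem_demand.1 hx').1
  have hl := Pi.le_def.1 hxs
  have hl' := Pi.le_def.1 hxs'
  rcases E.val_mNatConcave i x hxs x' hxs' j hj with h | ⟨k, hk, h⟩
  · refine .inl (mem_demand_of_add_eq hx hx' (Pi.le_def.2 ?_) (Pi.le_def.2 ?_) (funext ?_) h).1 <;>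
      intro l <;> have := hl l <;> have := hl' l <;>
      simp only [Pi.add_apply, Pi.sub_apply, Pi.single_apply] <;> split_ifs with a <;>
      (try subst a) <;> omega
  · refine .inr ⟨k, hk, mem_demand_of_add_eq hx hx' (Pi.le_def.2 ?_) (Pi.le_def.2 ?_) (funext ?_) h⟩ <;>
      intro l <;> have := hl l <;> have := hl' l <;>
      simp only [Pi.add_apply, Pi.sub_apply, Pi.single_apply] <;> split_ifs with a b b <;>
      (try subst a) <;> (try subst b) <;> omega

/-- Move `y` towards `x` by exchanges. Dropping a unit of `x` is excluded by its minimality, so each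
exchange keeps the size of `y`. Minimality for inclusion is thus minimality of size. -/
theorem sum_le_of_mem_minDemand {x y : M → ℕ} (hx : x ∈ E.minDemand p i) (hy : y ∈ E.demand p i) :
    ∑ j, x j ≤ ∑ j, y j := by
  induction hn : ∑ j, (x j - y j + (y j - x j)) using Nat.strong_induction_on generalizing y with
  | _ n ih =>
    by_cases hxy : x ≤ y
    · exact sum_le_sum fun j _ => hxy j
    obtain ⟨j, hj⟩ : ∃ j, y j < x j := by
      by_contra! h
      exact hxy h
    rcases exchange_demand (mem_minDemand.1 hx).1 hy hj with h | ⟨k, hk, -, h⟩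
    · have := congrFun ((mem_minDemand.1 hx).2 _ h (fun l => Nat.sub_le _ _)) j
      simp at this
      omega
    · have hkj : k ≠ j := by rintro rfl; omega
      have hlt : ∑ l, (x l - (y + Pi.single j 1 - Pi.single k 1 : M → ℕ) l +
          ((y + Pi.single j 1 - Pi.single k 1 : M → ℕ) l - x l)) < n := by
        rw [← hn]
        refine sum_lt_sum (fun l _ => ?_) ⟨j, mem_univ _, ?_⟩
        · simp only [Pi.add_apply, Pi.sub_apply, Pi.single_apply]
          split_ifs with a b b <;> (try subst a) <;> (try subst b) <;> omega
        · simp [hkj.symm]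
          omega
      refine (ih _ hlt h rfl).trans_eq ?_
      have e : y + Pi.single j 1 - Pi.single k 1 + Pi.single k 1 = y + Pi.single j 1 := by
        ext l
        simp only [Pi.add_apply, Pi.sub_apply, Pi.single_apply]
        split_ifs with a b b <;> (try subst a) <;> (try subst b) <;> omega
      have := congrArg (fun f : M → ℕ => ∑ l, f l) e
      simp only [Pi.add_apply, sum_add_distrib, sum_pi_single', mem_univ, if_true] at this
      omega

theorem eq_of_le_of_sum_le {x y : M → ℕ} (h : y ≤ x) (hs : ∑ j, x j ≤ ∑ j, y j) : y = x := by
  ext j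
  exact (sum_eq_sum_iff_of_le fun j _ => h j).1
    (le_antisymm (sum_le_sum fun j _ => h j) hs) j (mem_univ j)

theorem mem_minDemand_of_sum_le {x y : M → ℕ} (hx : x ∈ E.minDemand p i)
    (hy : y ∈ E.demand p i) (h : ∑ j, y j ≤ ∑ j, x j) : y ∈ E.minDemand p i :=
  mem_minDemand.2 ⟨hy, fun _ hu huy =>
    eq_of_le_of_sum_le huy (h.trans (sum_le_of_mem_minDemand hx hu))⟩

theorem exists_minDemand_le {y : M → ℕ} (hy : y ∈ E.demand p i) :
    ∃ x ∈ E.minDemand p i, x ≤ y := by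
  classical
  obtain ⟨x, hx, hmin⟩ := ((E.demand p i).filter (· ≤ y)).exists_min_image (fun x => ∑ j, x j)
    ⟨y, mem_filter.2 ⟨hy, le_rfl⟩⟩
  obtain ⟨hxD, hxy⟩ := mem_filter.1 hx
  exact ⟨x, mem_minDemand.2 ⟨hxD, fun u hu hux =>
    eq_of_le_of_sum_le hux (hmin u (mem_filter.2 ⟨hu, hux.trans hxy⟩))⟩, hxy⟩

variable (E p i)

theorem minDemand_nonempty : (E.minDemand p i).Nonempty := by
  obtain ⟨y, hy⟩ := E.demand_nonempty p i
  obtain ⟨x, hx, -⟩ := exists_minDemand_le hy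
  exact ⟨x, hx⟩

theorem mConvex_minDemand : MConvex (toInt (E.minDemand p i : Set (M → ℕ))) := by
  rintro _ ⟨x, hx, rfl⟩ _ ⟨y, hy, rfl⟩ j hj
  have hj : y j < x j := by simpa using hj
  rw [mem_coe] at hx hy
  rcases exchange_demand (mem_minDemand.1 hx).1 (mem_minDemand.1 hy).1 hj with h | ⟨k, hk, h1, h2⟩
  · have := congrFun ((mem_minDemand.1 hx).2 _ h (fun l => Nat.sub_le _ _)) j
    simp at this
    omega
  · have hkj : k ≠ j := by rintro rfl; omega
    have e1 : x - Pi.single j 1 + Pi.single k 1 + Pi.single j 1 = x + Pi.single k 1 := by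
      ext l
      simp only [Pi.add_apply, Pi.sub_apply, Pi.single_apply]
      split_ifs with a b b <;> (try subst a) <;> (try subst b) <;> omega
    have e2 : y + Pi.single j 1 - Pi.single k 1 + Pi.single k 1 = y + Pi.single j 1 := by
      ext l
      simp only [Pi.add_apply, Pi.sub_apply, Pi.single_apply]
      split_ifs with a b b <;> (try subst a) <;> (try subst b) <;> omega
    have s1 := congrArg (fun f : M → ℕ => ∑ l, f l) e1
    have s2 := congrArg (fun f : M → ℕ => ∑ l, f l) e2
    simp only [Pi.add_apply, sum_add_distrib, sum_pi_single', mem_univ, if_true] at s1 s2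
    refine ⟨k, by simpa using hk,
      ⟨_, mem_minDemand_of_sum_le hx h1 ?_, ?_⟩, ⟨_, mem_minDemand_of_sum_le hy h2 ?_, ?_⟩⟩
    · simp only [Pi.add_apply, sum_add_distrib, sum_pi_single', mem_univ, if_true]
      omega
    · ext l
      have := congrFun e1 l
      simp only [Pi.add_apply, Pi.sub_apply, Pi.single_apply] at this ⊢
      split_ifs at this ⊢ <;> omega
    · omega
    · ext l
      have := congrFun e2 l
      simp only [Pi.add_apply, Pi.sub_apply, Pi.single_apply] at this ⊢
      split_ifs at this ⊢ <;> omega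

theorem rank_eq_rankOf : E.rank p i = rankOf (E.minDemand p i) := rfl

variable {E p i} in
theorem sum_eq_rank_univ {b : M → ℕ} (hb : b ∈ E.minDemand p i) :
    ∑ j, b j = E.rank p i univ :=
  le_antisymm (sum_le_rankOf hb univ)
    (Finset.sup_le fun _ hy => sum_le_of_mem_minDemand hy (mem_minDemand.1 hb).1)

/-- All minimal bundles have the same size, so having least on `S` is having most on the complement.
-/
theorem requirement_add_rank (S : Finset M) :
    E.requirement p i S + E.rank p i Sᶜ = E.rank p i univ := by
  obtain ⟨b, hb, -, hbS⟩ := exists_sum_eq_rankOf (E.mConvex_minDemand p i)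
    (E.minDemand_nonempty p i) (Subset.refl Sᶜ)
  have hreq : E.requirement p i S = ∑ j ∈ S, b j := by
    refine IsLeast.csInf_eq ⟨⟨b, (mem_minDemand.1 hb).1, rfl⟩, ?_⟩
    rintro _ ⟨y, hy, rfl⟩
    obtain ⟨x, hx, hxy⟩ := exists_minDemand_le (mem_coe.1 hy)
    have h1 := sum_le_rankOf hx Sᶜ
    have h2 := sum_add_sum_compl S x
    have h3 := sum_add_sum_compl S b
    have h4 := sum_eq_rank_univ hx
    have h5 := sum_eq_rank_univ hb
    have h6 : ∑ j ∈ S, x j ≤ ∑ j ∈ S, y j := sum_le_sum fun j _ => hxy j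
    change _ ≤ ∑ j ∈ S, y j
    omega
  rw [hreq, rank_eq_rankOf, ← hbS, sum_add_sum_compl, sum_eq_rank_univ hb, rank_eq_rankOf]

/-- Maximizing over-demand is minimizing the cut bound in the min-max formula for the size of an
allocation; see `card_le`. -/
theorem overDemand_eq (S : Finset M) : E.overDemand p S =
    ∑ i, (E.rank p i univ : ℤ) - (∑ i, (E.rank p i Sᶜ : ℤ) + ∑ j ∈ S, (E.supply j : ℤ)) := by
  rw [overDemand, ← sub_sub, ← sum_sub_distrib]
  congr 1
  refine sum_congr rfl fun i _ => ?_
  have := E.requirement_add_rank p i S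
  omega

end Market

namespace DiscreteConvex

/-! ### Duality and comparison of competitive prices. -/

section Value

variable {N M V : Type*} [Fintype N] [Fintype M] [DecidableEq M]
  [AddCommGroup V] [LinearOrder V] [IsOrderedAddMonoid V]

theorem bundleValue_sub (c z : M → V) (y : M → ℕ) : bundleValue (c - z) y = bundleValue c y - bundleValue z y := by
  simp [bundleValue, nsmul_sub]

theorem bundleValue_add (c : M → V) (y y' : M → ℕ) : bundleValue c (y + y') = bundleValue c y + bundleValue c y' := by
  simp [bundleValue, add_nsmul, sum_add_distrib]

@[simp]
theorem bundleValue_single (c : M → V) (j : M) : bundleValue c (Pi.single j 1) = c j := by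
  rw [bundleValue, sum_eq_single j] <;> simp +contextual

theorem sum_bundleValue (c : M → V) (x : N → M → ℕ) :
    ∑ i, bundleValue c (x i) = bundleValue c fun j => ∑ i, x i j := by
  simp only [bundleValue, sum_smul]
  rw [sum_comm]

theorem bundleValue_mono {c : M → V} (hc : 0 ≤ c) {y y' : M → ℕ} (h : ∀ j, y j ≤ y' j) :
    bundleValue c y ≤ bundleValue c y' :=
  sum_le_sum fun j _ => nsmul_le_nsmul_left (hc j) (h j)

theorem bundleValue_exchange (c : M → V) {y : M → ℕ} {j : M} (hj : 0 < y j) :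
    bundleValue c (y - Pi.single j 1) = bundleValue c y - c j := by
  have : y - Pi.single j 1 + Pi.single j 1 = y := by
    ext l
    by_cases hl : l = j
    · subst hl; simp; omega
    · simp [hl]
  rw [eq_sub_iff_add_eq, ← bundleValue_single c j, ← bundleValue_add, this]

/-- Prices that remain optimal when the supply of `j` grows are minimal at `j`. -/
theorem price_le_of_augment {w : N → M → V} {s : M → ℕ} {z z' : M → V} {x x' : N → M → ℕ} {j : M}
    {q : N → V} (h : ∀ i, bundleValue (w i - z) (x i) ≤ bundleValue (w i - z) (x' i))
    (h1 : bundleValue z (s + Pi.single j 1) ≤ ∑ i, bundleValue z (x' i))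
    (h2 : ∑ i, bundleValue z' (x' i) ≤ bundleValue z' (s + Pi.single j 1))
    (hq : ∀ i, bundleValue (w i - z') (x' i) ≤ q i)
    (hle : ∑ i, q i + bundleValue z' s ≤ ∑ i, bundleValue (w i - z) (x i) + bundleValue z s) : z j ≤ z' j := by
  have a1 := sum_le_sum fun i (_ : i ∈ univ) => h i
  have a2 := sum_le_sum fun i (_ : i ∈ univ) => hq i
  rw [bundleValue_add, bundleValue_single] at h1 h2
  have e : ∑ i, bundleValue (w i - z) (x' i) + ∑ i, bundleValue z (x' i) =
      ∑ i, bundleValue (w i - z') (x' i) + ∑ i, bundleValue z' (x' i) := by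
    simp [bundleValue_sub, sum_sub_distrib]
  -- The optimal dual value at supply `s + χ_j` is attained by `z`, hence is at most the one of
  -- `z'`. Subtracting the comparison at supply `s` leaves the price of `j`.
  have : ∑ i, bundleValue (w i - z) (x i) + bundleValue z s + z j ≤
      ∑ i, bundleValue (w i - z) (x i) + bundleValue z s + z' j := by
    calc _ = ∑ i, bundleValue (w i - z) (x i) + (bundleValue z s + z j) := by abel
      _ ≤ ∑ i, bundleValue (w i - z) (x' i) + ∑ i, bundleValue z (x' i) := add_le_add a1 h1
      _ = ∑ i, bundleValue (w i - z') (x' i) + ∑ i, bundleValue z' (x' i) := e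
      _ ≤ ∑ i, q i + (bundleValue z' s + z' j) := add_le_add a2 h2
      _ = (∑ i, q i + bundleValue z' s) + z' j := by abel
      _ ≤ _ := by gcongr
  exact (add_le_add_iff_left _).1 this

section Competitive

variable {B : N → Set (M → ℕ)} {w : N → M → V} {s : M → ℕ} {z : M → V} {x : N → M → ℕ}

theorem IsCompetitive.value_supply (h : IsCompetitive B w s z x) :
    ∑ i, bundleValue z (x i) = bundleValue z s := by
  rw [sum_bundleValue]
  refine sum_congr rfl fun j _ => ?_
  rcases (h.feasible j).lt_or_eq with hlt | heq
  · simp [h.slack j hlt]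
  · simp only [heq]

theorem IsCompetitive.sum_value_eq (h : IsCompetitive B w s z x) :
    ∑ i, bundleValue (w i) (x i) = ∑ i, bundleValue (w i - z) (x i) + bundleValue z s := by
  simp [bundleValue_sub, sum_sub_distrib, h.value_supply]

/-- Weak duality. -/
theorem sum_value_le {z' : M → V} (hz' : 0 ≤ z') {y : N → M → ℕ} (hy : ∀ j, ∑ i, y i j ≤ s j) :
    ∑ i, bundleValue (w i) (y i) ≤ ∑ i, bundleValue (w i - z') (y i) + bundleValue z' s := by
  have h1 : ∑ i, bundleValue z' (y i) ≤ bundleValue z' s := by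
    rw [sum_bundleValue]; exact bundleValue_mono hz' hy
  simp only [bundleValue_sub, sum_sub_distrib]
  calc _ = ∑ i, bundleValue (w i) (y i) - ∑ i, bundleValue z' (y i) + ∑ i, bundleValue z' (y i) := by abel
    _ ≤ _ := by gcongr

/-- Every optimal allocation is supported by every competitive price vector. -/
theorem IsCompetitive.of_sum_value_le (h : IsCompetitive B w s z x) {y : N → M → ℕ}
    (hy : ∀ i, y i ∈ lowerClosure (B i)) (hys : ∀ j, ∑ i, y i j ≤ s j)
    (hle : ∑ i, bundleValue (w i) (x i) ≤ ∑ i, bundleValue (w i) (y i)) : IsCompetitive B w s z y := by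
  have h1 : ∀ i ∈ univ, bundleValue (w i - z) (y i) ≤ bundleValue (w i - z) (x i) :=
    fun i _ => h.opt i _ (hy i)
  have h2 : ∀ j ∈ univ, (∑ i, y i j) • z j ≤ s j • z j :=
    fun j _ => nsmul_le_nsmul_left (h.nonneg j) (hys j)
  have e : ∑ i, bundleValue (w i) (y i) =
      ∑ i, bundleValue (w i - z) (y i) + bundleValue z fun j => ∑ i, y i j := by
    rw [← sum_bundleValue]
    simp [bundleValue_sub, sum_sub_distrib]
  rw [h.sum_value_eq, e] at hle
  have g1 := sum_le_sum h1
  have g2 : (bundleValue z fun j => ∑ i, y i j) ≤ bundleValue z s := sum_le_sum h2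
  -- Two termwise inequalities whose sum is an equality: each surplus is optimal, and each good is
  -- sold out or free.
  have e1 : ∑ i, bundleValue (w i - z) (y i) = ∑ i, bundleValue (w i - z) (x i) :=
    le_antisymm g1 (le_of_add_le_add_right (hle.trans (add_le_add_right g2 _)))
  have e2 : (bundleValue z fun j => ∑ i, y i j) = bundleValue z s :=
    le_antisymm g2 (le_of_add_le_add_left (hle.trans (add_le_add_left g1 _)))
  have e1' := (sum_eq_sum_iff_of_le h1).1 e1
  have e2' := (sum_eq_sum_iff_of_le h2).1 e2
  refine ⟨hy, fun i y' hy' => (e1' i (mem_univ i)).symm ▸ h.opt i y' hy', h.nonneg, hys,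
    fun j hj => ?_⟩
  by_contra hz
  have hpos : 0 < z j := lt_of_le_of_ne (h.nonneg j) (Ne.symm hz)
  exact (nsmul_left_strictMono hpos hj).ne (e2' j (mem_univ j))

theorem IsCompetitive.price_le_weight (h : IsCompetitive B w s z x) {i : N} {j : M}
    (hj : 0 < x i j) : z j ≤ w i j := by
  have := h.opt i (x i - Pi.single j 1)
    ((lowerClosure (B i)).lower (fun l => Nat.sub_le _ _) (h.mem i))
  rw [bundleValue_exchange _ hj, sub_le_self_iff] at this
  exact sub_nonneg.1 this

theorem IsCompetitive.sum_eq (h : IsCompetitive B w s z x) {j : M} (hj : z j ≠ 0) :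
    ∑ i, x i j = s j :=
  (h.feasible j).eq_of_not_lt fun hlt => hj (h.slack j hlt)

theorem IsCompetitive.value_eq {s' : M → ℕ} {x' : N → M → ℕ} (h : IsCompetitive B w s z x)
    (h' : IsCompetitive B w s' z x') (i : N) :
    bundleValue (w i - z) (x i) = bundleValue (w i - z) (x' i) :=
  le_antisymm (h'.opt i _ (h.mem i)) (h.opt i _ (h'.mem i))

theorem IsCompetitive.price_le {j : M} {x' : N → M → ℕ} (h : IsCompetitive B w s z x)
    (h' : IsCompetitive B w (s + Pi.single j 1) z x') {z' : M → V} (hz' : 0 ≤ z') {q : N → V}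
    (hq : ∀ i, bundleValue (w i - z') (x' i) ≤ q i)
    (hle : ∑ i, q i + bundleValue z' s ≤ ∑ i, bundleValue (w i - z) (x i) + bundleValue z s) : z j ≤ z' j :=
  price_le_of_augment (fun i => (h.value_eq h' i).le) h'.value_supply.ge
    (by rw [sum_bundleValue]; exact bundleValue_mono hz' h'.feasible) hq hle

theorem IsCompetitive.price_le_of_isCompetitive {j : M} {x' : N → M → ℕ} {z' : M → V}
    (h : IsCompetitive B w s z x) (h' : IsCompetitive B w (s + Pi.single j 1) z x')
    (h'' : IsCompetitive B w s z' x) : z j ≤ z' j :=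
  h.price_le h' h''.nonneg (fun i => h''.opt i _ (h'.mem i))
    (by rw [← h''.sum_value_eq, ← h.sum_value_eq])

end Competitive

end Value

/-! ### Lyapunov minimizers and equilibria of the frictionless market. -/

section Frictionless

variable {N J V : Type*} [Fintype N] [Fintype J] [DecidableEq J]
  [AddCommGroup V] [LinearOrder V] [IsOrderedAddMonoid V]
  {ρ : N → Finset J → ℕ} {w : N → J → V} {s : J → ℕ} {z : J → V}

theorem utility_linearValuation {ρ : Finset J → ℕ} (w z : J → V) {y : J → ℕ}
    (hy : y ∈ polymatroid ρ) :
    utility (linearValuation ρ w) z y = (bundleValue (w - z) y : V) := by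
  rw [utility, linearValuation, if_pos hy, ← WithBot.coe_add, ← sub_eq_add_neg, bundleValue_sub]
  rfl

theorem utility_linearValuation_eq_bot {ρ : Finset J → ℕ} (w z : J → V) {y : J → ℕ}
    (hy : y ∉ polymatroid ρ) : utility (linearValuation ρ w) z y = ⊥ := by
  rw [utility, linearValuation, if_neg hy, WithBot.bot_add]

theorem coe_le_lyapunov {y : N → J → ℕ} (hy : ∀ i, y i ∈ polymatroid (ρ i)) (hys : ∀ i, y i ≤ s) :
    ((∑ i, bundleValue (w i - z) (y i) + bundleValue z s : V) : WithBot V) ≤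
      lyapunov s (fun i => linearValuation (ρ i) (w i)) z := by
  rw [lyapunov, WithBot.coe_add]
  refine add_le_add ((WithBot.coe_sum _ _).trans_le (sum_le_sum fun i _ => ?_)) le_rfl
  rw [← utility_linearValuation (w i) z (hy i)]
  exact le_sup (f := utility (linearValuation (ρ i) (w i)) z) (mem_Iic.2 (hys i))

theorem lyapunov_le_coe {q : N → V} (hq : ∀ i, ∀ y ∈ polymatroid (ρ i), bundleValue (w i - z) y ≤ q i) :
    lyapunov s (fun i => linearValuation (ρ i) (w i)) z ≤
      ((∑ i, q i + bundleValue z s : V) : WithBot V) := by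
  rw [lyapunov, WithBot.coe_add]
  refine add_le_add ((sum_le_sum fun i _ => Finset.sup_le fun y _ => ?_).trans_eq
    (WithBot.coe_sum _ _).symm) le_rfl
  by_cases hy : y ∈ polymatroid (ρ i)
  · rw [utility_linearValuation _ _ hy]
    exact WithBot.coe_le_coe.2 (hq i y hy)
  · rw [utility_linearValuation_eq_bot _ _ hy]
    exact bot_le

/-- Market clearing prices that still clear the market when the supply of any one good grows are
the least minimizer of the Lyapunov function and the minimum equilibrium price vector. -/
theorem isLeast_frictionless (hz : 0 ≤ z) {x : N → J → ℕ}
    (hx : ∀ i, x i ∈ polymatroid (ρ i)) (hxs : ∀ i, x i ≤ s) (hsum : ∀ j, ∑ i, x i j = s j)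
    (hopt : ∀ i, ∀ y ∈ polymatroid (ρ i), bundleValue (w i - z) y ≤ bundleValue (w i - z) (x i))
    (haug : ∀ j, ∃ x' : N → J → ℕ, (∀ i, x' i ∈ polymatroid (ρ i)) ∧ (∀ i, x' i ≤ s) ∧
      (∀ l, ∑ i, x' i l = (s + Pi.single j 1 : J → ℕ) l) ∧
      ∀ i, bundleValue (w i - z) (x i) ≤ bundleValue (w i - z) (x' i)) :
    IsLeast (minimizers (lyapunov s fun i => linearValuation (ρ i) (w i))) z ∧
      IsLeast {z' | IsEquilibriumPrice s (fun i => linearValuation (ρ i) (w i)) z'} z := by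
  have sum_eq : ∀ (z' : J → V) (y : N → J → ℕ) (t : J → ℕ), (∀ j, ∑ i, y i j = t j) →
      ∑ i, bundleValue z' (y i) = bundleValue z' t := fun z' y t h => by
    rw [sum_bundleValue]; congr 1; ext j; exact h j
  have total : ∀ (z' : J → V) (y : N → J → ℕ), (∀ j, ∑ i, y i j = s j) →
      ∑ i, bundleValue (w i - z') (y i) + bundleValue z' s = ∑ i, bundleValue (w i) (y i) := fun z' y h => by
    simp [bundleValue_sub, sum_sub_distrib, sum_eq z' y s h]
  refine ⟨⟨⟨hz, fun z' _ => ?_⟩, fun z' hz' j => ?_⟩, ⟨hz, x, fun i => ⟨hxs i, fun y _ => ?_⟩, ?_⟩,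
    ?_⟩
  · refine (lyapunov_le_coe hopt).trans (le_trans ?_ (coe_le_lyapunov hx hxs))
    rw [total z x hsum, total z' x hsum]
  · obtain ⟨x', hx', hxs', hsum', hle⟩ := haug j
    refine price_le_of_augment hle (sum_eq z x' _ hsum').ge (sum_eq z' x' _ hsum').le
      (fun i => le_rfl) ?_
    exact WithBot.coe_le_coe.1 ((coe_le_lyapunov hx' hxs').trans
      ((hz'.2 z hz).trans (lyapunov_le_coe hopt)))
  · rw [utility_linearValuation _ _ (hx i)]
    by_cases hy : y ∈ polymatroid (ρ i)
    · rw [utility_linearValuation _ _ hy]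
      exact WithBot.coe_le_coe.2 (hopt i y hy)
    · rw [utility_linearValuation_eq_bot _ _ hy]
      exact bot_le
  · ext j; rw [Finset.sum_apply, hsum]
  · rintro z' ⟨hz', y, hy, hys⟩ j
    obtain ⟨x', hx', hxs', hsum', hle⟩ := haug j
    -- A bundle of utility `⊥` cannot be optimal, since `x i` has finite utility.
    have hyP : ∀ i, y i ∈ polymatroid (ρ i) := by
      intro i
      by_contra hn
      have := (hy i).2 (x i) (hxs i)
      rw [utility_linearValuation _ _ (hx i), utility_linearValuation_eq_bot _ _ hn] at this
      simp at this
    have hysum : ∀ j, ∑ i, y i j = s j := fun j => by rw [← hys, Finset.sum_apply]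
    refine price_le_of_augment (q := fun i => bundleValue (w i - z') (y i)) hle
      (sum_eq z x' _ hsum').ge (sum_eq z' x' _ hsum').le (fun i => ?_) ?_
    · have := (hy i).2 (x' i) (hxs' i)
      rw [utility_linearValuation _ _ (hx' i), utility_linearValuation _ _ (hyP i)] at this
      exact WithBot.coe_le_coe.1 this
    · rw [total z' y hysum, ← total z y hysum]
      gcongr with i
      exact hopt i _ (hyP i)

end Frictionless

end DiscreteConvex

/-! ### Main parts of dual prices, and the auxiliary market on `X`. -/

/-- The main part `a` of a number `a + γ b`. -/
def mainPart : LexReal →+ ℝ where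
  toFun a := (ofLex a).1
  map_zero' := rfl
  map_add' _ _ := rfl

theorem mainPart_mono {a b : LexReal} (h : a ≤ b) : mainPart a ≤ mainPart b :=
  Prod.Lex.monotone_fst a b h

namespace Market

open DiscreteConvex

variable {N M : Type*} [Fintype N] [Fintype M] [DecidableEq M] {E : Market N M} {p : M → ℝ}

variable (E p) in
/-- Competitive prices and allocations in the problem with the weights `w i j` and the minimal
demand sets. -/
abbrev IsDualPair (s : M → ℕ) (z : M → LexReal) (x : N → M → ℕ) : Prop :=
  IsCompetitive (fun i => (E.minDemand p i : Set (M → ℕ))) (E.weight p) s z x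

theorem mem_polymatroid_rank {i : N} {x : M → ℕ} : x ∈ polymatroid (E.rank p i) ↔
    x ∈ lowerClosure (E.minDemand p i : Set (M → ℕ)) :=
  mem_polymatroid_rankOf (E.mConvex_minDemand p i) (E.minDemand_nonempty p i)

theorem mainPart_value (c : M → LexReal) (y : M → ℕ) :
    mainPart (bundleValue c y) = ∑ j, (y j : ℝ) * mainPart (c j) := by
  rw [bundleValue, map_sum]
  exact sum_congr rfl fun j _ => by rw [map_nsmul, nsmul_eq_mul]

theorem mainPart_weight (i : N) (j : M) : mainPart (E.weight p i j) = 1 := rfl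

theorem mainPart_sum_value (y : N → M → ℕ) :
    mainPart (∑ i, bundleValue (E.weight p i) (y i)) = ((∑ i, ∑ j, y i j : ℕ) : ℝ) := by
  simp [map_sum, mainPart_value, mainPart_weight]

variable {s : M → ℕ} {z : M → LexReal} {x : N → M → ℕ}

theorem mainPart_value_weight_sub {Y : Finset M}
    (hY : ∀ j, mainPart (z j) = if j ∈ Y then 1 else 0) (i : N) (y : M → ℕ) :
    mainPart (bundleValue (E.weight p i - z) y) = ((∑ j ∈ Yᶜ, y j : ℕ) : ℝ) := by
  rw [mainPart_value]
  push_cast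
  rw [← sum_add_sum_compl Y, sum_eq_zero, zero_add]
  · refine sum_congr rfl fun j hj => ?_
    simp [mainPart_weight, hY, mem_compl.1 hj]
  · intro j hj
    simp [mainPart_weight, hY, hj]

/-- The main part of a surplus counts the units outside `Y`, so an optimal part takes as many of
them as any minimal bundle does. This makes restriction to the contracted polymatroid possible. -/
theorem sum_compl_eq_rank (h : E.IsDualPair p s z x) {Y : Finset M}
    (hY : ∀ j, mainPart (z j) = if j ∈ Y then 1 else 0) (i : N) :
    ∑ j ∈ Yᶜ, x i j = E.rank p i Yᶜ := by
  refine le_antisymm ((mem_polymatroid _ _).1 (mem_polymatroid_rank.2 (h.mem i)) _)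
    (Finset.sup_le fun b hb => ?_)
  have := mainPart_mono (h.opt i b (subset_lowerClosure hb))
  rw [mainPart_value_weight_sub hY, mainPart_value_weight_sub hY] at this
  exact_mod_cast this

/-- Weak duality for the size: units in `S` are bounded by supply, the others by rank. -/
theorem card_le (S : Finset M)
    (hx : ∀ i, x i ∈ lowerClosure (E.minDemand p i : Set (M → ℕ))) (hxs : ∀ j, ∑ i, x i j ≤ s j) :
    ∑ i, ∑ j, x i j ≤ ∑ i, E.rank p i Sᶜ + ∑ j ∈ S, s j := by
  have h1 : ∑ i, ∑ j ∈ S, x i j ≤ ∑ j ∈ S, s j := by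
    rw [sum_comm]; exact sum_le_sum fun j _ => hxs j
  have h2 : ∑ i, ∑ j ∈ Sᶜ, x i j ≤ ∑ i, E.rank p i Sᶜ :=
    sum_le_sum fun i _ => (mem_polymatroid _ _).1 (mem_polymatroid_rank.2 (hx i)) _
  calc _ = ∑ i, (∑ j ∈ S, x i j + ∑ j ∈ Sᶜ, x i j) := by simp_rw [sum_add_sum_compl]
    _ ≤ _ := by rw [sum_add_distrib]; omega

theorem isMaxOverDemanded_iff {S : Finset M} : E.IsMaxOverDemanded p S ↔
    ∀ T, ∑ i, E.rank p i Sᶜ + ∑ j ∈ S, E.supply j ≤ ∑ i, E.rank p i Tᶜ + ∑ j ∈ T, E.supply j := by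
  refine forall_congr' fun T => ?_
  rw [overDemand_eq, overDemand_eq, sub_le_sub_iff_left]
  norm_cast

/-- The main part of the least dual solution is the indicator of the minimal maximizer of the
over-demand function. -/
theorem mainPart_price (h : E.IsDualPair p E.supply z x)
    (haug : ∀ j, ∃ x', E.IsDualPair p (E.supply + Pi.single j 1) z x') {X : Finset M}
    (hX : Minimal (E.IsMaxOverDemanded p) X) (j : M) :
    mainPart (z j) = if j ∈ X then 1 else 0 := by
  -- The price of `j` is the gain in optimal value from one more unit, and the main part of a value
  -- is the number of units allocated.
  have hcard : ∀ j x', E.IsDualPair p (E.supply + Pi.single j 1) z x' →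
      mainPart (z j) = ((∑ i, ∑ j, x' i j : ℕ) : ℝ) - ((∑ i, ∑ j, x i j : ℕ) : ℝ) := by
    intro j x' h'
    rw [← mainPart_sum_value (E := E) (p := p), ← mainPart_sum_value (E := E) (p := p), ← map_sub,
      h.sum_value_eq, h'.sum_value_eq, bundleValue_add, bundleValue_single,
      sum_congr rfl fun i _ => h.value_eq h' i]
    congr 1
    abel
  have h01 : ∀ j, mainPart (z j) = 0 ∨ mainPart (z j) = 1 := by
    intro j
    obtain ⟨x', h'⟩ := haug j
    have h0 : 0 ≤ mainPart (z j) := mainPart_mono (h.nonneg j)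
    -- A good with a nonzero price is still sold out after its supply has grown, so some buyer uses
    -- it and its price is at most a weight. The added unit makes this work even for zero supply.
    have h1 : mainPart (z j) ≤ 1 := by
      by_contra! hgt
      have hz : z j ≠ 0 := by
        intro h0
        rw [h0, map_zero] at hgt
        linarith
      have hsum := h'.sum_eq hz
      obtain ⟨i, -, hi⟩ : ∃ i ∈ univ, x' i j ≠ 0 := by
        apply exists_ne_zero_of_sum_ne_zero
        rw [hsum]
        simp
      have := mainPart_mono (h'.price_le_weight (Nat.pos_of_ne_zero hi))
      rw [mainPart_weight] at this
      linarith
    rw [hcard j x' h'] at h0 h1 ⊢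
    have h0' : ∑ i, ∑ j, x i j ≤ ∑ i, ∑ j, x' i j := by
      rw [sub_nonneg] at h0; exact_mod_cast h0
    have h1' : ∑ i, ∑ j, x' i j ≤ 1 + ∑ i, ∑ j, x i j := by
      rw [sub_le_iff_le_add] at h1; exact_mod_cast h1
    rcases h0'.eq_or_lt with heq | hlt
    · left; rw [heq, sub_self]
    · right
      rw [show ∑ i, ∑ j, x' i j = 1 + ∑ i, ∑ j, x i j by omega]
      push_cast; ring
  classical
  let Y : Finset M := univ.filter fun j => mainPart (z j) = 1
  have hY : ∀ j, mainPart (z j) = if j ∈ Y then 1 else 0 := by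
    intro j
    by_cases hj : mainPart (z j) = 1
    · rw [hj, if_pos (by simpa [Y] using hj)]
    · rw [(h01 j).resolve_right hj, if_neg (by simpa [Y] using hj)]
  -- Goods in `Y` are sold out, and outside `Y` every buyer attains the rank: the bound of `card_le`
  -- is tight for `Y`.
  have hYcard : ∑ i, ∑ j, x i j = ∑ i, E.rank p i Yᶜ + ∑ j ∈ Y, E.supply j := by
    have h1 : ∑ j ∈ Y, E.supply j = ∑ i, ∑ j ∈ Y, x i j := by
      rw [sum_comm]
      refine sum_congr rfl fun j hj => (h.sum_eq fun h0 => ?_).symm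
      have := hY j
      rw [h0, if_pos hj, map_zero] at this
      exact zero_ne_one this
    rw [h1, ← sum_add_distrib]
    refine sum_congr rfl fun i _ => ?_
    rw [← sum_compl_eq_rank h hY i, add_comm, sum_add_sum_compl]
  have hYmax : E.IsMaxOverDemanded p Y :=
    isMaxOverDemanded_iff.2 fun T => hYcard ▸ card_le T h.mem h.feasible
  -- For `j` in `Y` but not in `X`, an extra unit of `j` would enlarge the allocation, although the
  -- bound given by `X` is already tight and does not involve the supply of `j`.
  have hYX : Y ⊆ X := by
    intro j hj
    by_contra hjX
    obtain ⟨x', h'⟩ := haug j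
    have h1 := card_le X h'.mem h'.feasible
    have h2 := isMaxOverDemanded_iff.1 hX.1 Y
    have h3 : ∑ l ∈ X, (E.supply + Pi.single j 1 : M → ℕ) l = ∑ l ∈ X, E.supply l :=
      sum_congr rfl fun l hl => by simp [show l ≠ j from fun e => hjX (e ▸ hl)]
    have h4 := hcard j x' h'
    rw [hY j, if_pos hj] at h4
    have h5 : ∑ i, ∑ j, x' i j = 1 + ∑ i, ∑ j, x i j := by
      have : ((∑ i, ∑ j, x' i j : ℕ) : ℝ) = 1 + ((∑ i, ∑ j, x i j : ℕ) : ℝ) := by linarith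
      exact_mod_cast this
    omega
  rw [hY j, subset_antisymm hYX (hX.2 hYmax hYX)]

/-- A price vector that stays competitive when the supply of any one good grows is the least
minimizer of the dual objective. -/
theorem isLeast_dualObjective (h : E.IsDualPair p E.supply z x)
    (haug : ∀ j, ∃ x', E.IsDualPair p (E.supply + Pi.single j 1) z x') :
    IsLeast (minimizers (E.dualObjective p)) z := by
  have hobj : E.dualObjective p z = ∑ i, bundleValue (E.weight p i - z) (x i) + bundleValue z E.supply := by
    refine congrArg (· + _) (sum_congr rfl fun i _ => le_antisymm ?_ ?_)
    · exact sup'_le _ _ fun y hy => h.opt i y (mem_polymatroid_rank.1 hy)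
    · exact le_sup' (bundleValue (E.weight p i - z)) (mem_polymatroid_rank.2 (h.mem i))
  have hle : ∀ z' (y : N → M → ℕ),
      (∀ i, y i ∈ lowerClosure (E.minDemand p i : Set (M → ℕ))) →
      ∑ i, bundleValue (E.weight p i - z') (y i) + bundleValue z' E.supply ≤ E.dualObjective p z' := by
    intro z' y hy
    refine add_le_add (sum_le_sum fun i _ => ?_) le_rfl
    exact le_sup' (bundleValue (E.weight p i - z')) (mem_polymatroid_rank.2 (hy i))
  refine ⟨⟨h.nonneg, fun z' hz' => ?_⟩, fun z' hz' j => ?_⟩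
  · rw [hobj, ← h.sum_value_eq]
    exact (sum_value_le hz' h.feasible).trans (hle z' x h.mem)
  · obtain ⟨x', h'⟩ := haug j
    refine h.price_le h' hz'.1 (fun i => le_rfl) ?_
    rw [← hobj]
    exact (hle z' x' h'.mem).trans (hz'.2 z h.nonneg)

theorem le_supply_of_mem {i : N} {y : M → ℕ}
    (hy : y ∈ lowerClosure (E.minDemand p i : Set (M → ℕ))) : y ≤ E.supply := by
  obtain ⟨b, hb, hyb⟩ := mem_lowerClosure.1 hy
  exact hyb.trans (mem_demand.1 (mem_minDemand.1 (mem_coe.1 hb)).1).1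

theorem value_extend {X : Finset M} (c : M → LexReal) (x : M → ℕ) (y : {j // j ∈ X} → ℕ) :
    bundleValue c (fun j => if h : j ∈ X then y ⟨j, h⟩ else x j) =
      bundleValue (fun j : {j // j ∈ X} => c j) y + ∑ j ∈ Xᶜ, x j • c j := by
  rw [bundleValue, ← sum_add_sum_compl X, ← sum_coe_sort X]
  congr 1
  · exact sum_congr rfl fun j _ => by simp
  · exact sum_congr rfl fun j hj => by simp [mem_compl.1 hj]

/-- The least dual solution solves the auxiliary frictionless market. -/
theorem isLeast_auxiliary (h : E.IsDualPair p E.supply z x)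
    (haug : ∀ j, ∃ x', E.IsDualPair p (E.supply + Pi.single j 1) z x') {X : Finset M}
    (hX : ∀ j, mainPart (z j) = if j ∈ X then 1 else 0) :
    IsLeast (minimizers (lyapunov (E.auxSupply X) (E.auxValuation p X)))
        (fun j : {j // j ∈ X} => z j) ∧
      IsLeast {z' | IsEquilibriumPrice (E.auxSupply X) (E.auxValuation p X) z'}
        (fun j : {j // j ∈ X} => z j) := by
  have hz : ∀ j ∈ X, z j ≠ 0 := fun j hj h0 => by
    have := hX j
    rw [h0, if_pos hj, map_zero] at this
    exact zero_ne_one this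
  have hself : ∀ y : M → ℕ, (fun j => if h : j ∈ X then (fun j : {j // j ∈ X} => y j) ⟨j, h⟩
      else y j) = y := fun y => by ext j; simp
  have hmem : ∀ {s x}, E.IsDualPair p s z x → ∀ i, (fun j : {j // j ∈ X} => x i j) ∈
      polymatroid (contractOnto (E.rank p i) X) := fun h i =>
    restrict_mem_polymatroid (mem_polymatroid_rank.2 (h.mem i)) (sum_compl_eq_rank h hX i)
  -- Complete `y` by the units of `x i` outside `X`; these contribute equally to both sides and
  -- cancel.
  have hopt : ∀ {s x}, E.IsDualPair p s z x → ∀ i,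
      ∀ y ∈ polymatroid (contractOnto (E.rank p i) X),
      bundleValue ((fun j : {j // j ∈ X} => E.weight p i j) - fun j : {j // j ∈ X} => z j) y ≤
        bundleValue ((fun j : {j // j ∈ X} => E.weight p i j) - fun j : {j // j ∈ X} => z j) fun j => x i j := by
    intro s x h i y hy
    have h1 := h.opt i _ (mem_polymatroid_rank.1 (extend_mem_polymatroid
      (E.mConvex_minDemand p i) (E.minDemand_nonempty p i) (mem_polymatroid_rank.2 (h.mem i)) hy))
    conv_rhs at h1 => rw [← hself (x i)]
    rw [value_extend, value_extend _ _ fun j : {j // j ∈ X} => x i j] at h1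
    exact le_of_add_le_add_right h1
  refine isLeast_frictionless (ρ := fun i => contractOnto (E.rank p i) X)
    (w := fun i j => E.weight p i j) (fun j => h.nonneg j) (hmem h)
    (fun i j => le_supply_of_mem (h.mem i) j) (fun j => h.sum_eq (hz j j.2)) (hopt h) fun j => ?_
  obtain ⟨x', h'⟩ := haug j
  refine ⟨fun i j => x' i j, hmem h', fun i j => le_supply_of_mem (h'.mem i) j, fun l => ?_,
    fun i => hopt h' i _ (hmem h i)⟩
  rw [h'.sum_eq (hz l l.2)]
  by_cases hl : l = j
  · subst hl; simp [auxSupply]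
  · have hl' : (l : M) ≠ j := fun e => hl (Subtype.ext e)
    simp [auxSupply, hl, hl']

theorem exists_isOptimalPrimal : ∃ x b : N → M → ℕ, E.IsOptimalPrimal p x ∧
    ∀ i, b i ∈ E.minDemand p i ∧ x i ≤ b i := by
  obtain ⟨z, ⟨x, h⟩, -⟩ := exists_isCompetitive (fun i => E.mConvex_minDemand p i)
    (fun i => E.minDemand_nonempty p i) (E.weight p) E.supply
  choose b hb hxb using fun i => mem_lowerClosure.1 (h.mem i)
  refine ⟨x, b, ⟨⟨fun i => mem_polymatroid_rank.2 (h.mem i), fun j => ?_⟩, fun x' hx' => ?_⟩,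
    fun i => ⟨hb i, hxb i⟩⟩
  · rw [Finset.sum_apply]; exact h.feasible j
  · change ∑ i, bundleValue (E.weight p i) (x' i) ≤ ∑ i, bundleValue (E.weight p i) (x i)
    rw [h.sum_value_eq]
    refine (sum_value_le (s := E.supply) h.nonneg fun j => ?_).trans ?_
    · rw [← Finset.sum_apply]; exact hx'.2 j
    · gcongr with i
      exact h.opt i _ (mem_polymatroid_rank.1 (hx'.1 i))

theorem IsOptimalPrimal.isDualPair {y : N → M → ℕ} (hy : E.IsOptimalPrimal p y)
    (h : E.IsDualPair p E.supply z x) : E.IsDualPair p E.supply z y := by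
  refine h.of_sum_value_le (fun i => mem_polymatroid_rank.1 (hy.1.1 i)) (fun j => ?_) ?_
  · rw [← Finset.sum_apply]; exact hy.1.2 j
  · refine hy.2 x ⟨fun i => mem_polymatroid_rank.2 (h.mem i), fun j => ?_⟩
    rw [Finset.sum_apply]; exact h.feasible j

end Market

/-! ### Assignment markets as competitive markets, and VCG payments. -/

namespace AssignmentMarket

open DiscreteConvex

variable {K J V : Type*} [Fintype K] [Fintype J] [DecidableEq J] [AddCommGroup V] [LinearOrder V]
  [IsOrderedAddMonoid V]

/-- The bundle of an option: one unit of a good, or nothing. -/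
def unitBundle (o : Option J) : J → ℕ := o.elim 0 fun j => Pi.single j 1

/-- The single units that a buyer accepts. -/
def unitBundles (A : AssignmentMarket K J V) (k : K) : Set (J → ℕ) :=
  {y | ∃ j, A.edge k j ∧ y = Pi.single j 1}

variable {A : AssignmentMarket K J V} {z : J → V} {y : K → Option J}

theorem mConvex_unitBundles (k : K) : MConvex (toInt (A.unitBundles k)) := by
  have hcast : ∀ j : J, (fun l => ((Pi.single j 1 : J → ℕ) l : ℤ)) = Pi.single j 1 := by
    intro j; ext l; simp [Pi.single_apply]
  rintro _ ⟨_, ⟨j, hj, rfl⟩, rfl⟩ _ ⟨_, ⟨l, hl, rfl⟩, rfl⟩ h hh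
  simp only [hcast] at hh ⊢
  obtain rfl : h = j := by
    by_contra hne
    rw [Pi.single_eq_of_ne hne, Pi.single_apply] at hh
    split_ifs at hh <;> omega
  have hlh : l ≠ h := by rintro rfl; exact lt_irrefl _ hh
  refine ⟨l, by simp [hlh], ⟨_, ⟨l, hl, rfl⟩, ?_⟩, ⟨_, ⟨h, hj, rfl⟩, ?_⟩⟩
  · exact (hcast l).trans (by abel)
  · exact (hcast h).trans (by abel)

/-- Some acceptable good is needed even for the empty option: the lower closure of the empty set
does not contain 0. -/
theorem unitBundle_mem (hA : ∀ k, ∃ j, A.edge k j) {k : K} {o : Option J}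
    (h : ∀ j, o = some j → A.edge k j) : unitBundle o ∈ lowerClosure (A.unitBundles k) := by
  rcases o with _ | j
  · obtain ⟨j, hj⟩ := hA k
    exact mem_lowerClosure.2 ⟨_, ⟨j, hj, rfl⟩, fun l => Nat.zero_le _⟩
  · exact subset_lowerClosure ⟨j, h j rfl, rfl⟩

theorem exists_unitBundle_eq {k : K} {a : J → ℕ} (ha : a ∈ lowerClosure (A.unitBundles k)) :
    ∃ o : Option J, unitBundle o = a ∧ ∀ j, o = some j → A.edge k j := by
  obtain ⟨_, ⟨j, hj, rfl⟩, haj⟩ := mem_lowerClosure.1 ha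
  have h0 : ∀ l, l ≠ j → a l = 0 := fun l hl => by
    have := haj l
    rw [Pi.single_eq_of_ne hl] at this
    exact Nat.le_zero.1 this
  by_cases h1 : a j = 0
  · refine ⟨none, ?_, by simp⟩
    ext l
    by_cases hl : l = j
    · subst hl; simp [unitBundle, h1]
    · simp [unitBundle, h0 l hl]
  · refine ⟨some j, ?_, by simpa using hj⟩
    ext l
    by_cases hl : l = j
    · subst hl
      have := haj l
      simp only [Pi.single_eq_same] at this
      simp [unitBundle]
      omega
    · simp [unitBundle, h0 l hl, hl]

theorem sold_eq (y : K → Option J) (j : J) : sold y j = ∑ k, unitBundle (y k) j := by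
  classical
  rw [sold, card_filter]
  refine sum_congr rfl fun k _ => ?_
  rcases y k with _ | l
  · simp [unitBundle]
  · simp [unitBundle, Pi.single_apply, eq_comm]

theorem value_unitBundle (c : J → V) (o : Option J) : bundleValue c (unitBundle o) = o.elim 0 c := by
  rcases o with _ | j
  · simp [bundleValue, unitBundle]
  · simp [unitBundle]

theorem surplus_eq (z : J → V) (k : K) (o : Option J) :
    A.surplus z k o = bundleValue (A.value k - z) (unitBundle o) := by
  rw [value_unitBundle]
  rcases o with _ | j <;> rfl

theorem welfare_eq (S : Finset K) (y : K → Option J) :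
    A.welfare S y = ∑ k ∈ S, bundleValue (A.value k) (unitBundle (y k)) := by
  simp [welfare, surplus_eq]

variable (A) in
/-- `y` is an assignment that gives every buyer a best option at prices `z` and sells every good
with a nonzero price. -/
def IsSupportedBy (z : J → V) (y : K → Option J) : Prop :=
  (∀ k j, y k = some j → A.edge k j) ∧
    IsCompetitive A.unitBundles A.value A.supply z fun k => unitBundle (y k)

theorem isSupportedBy_iff (hA : ∀ k, ∃ j, A.edge k j) : A.IsSupportedBy z y ↔
    (∀ k j, y k = some j → A.edge k j) ∧ 0 ≤ z ∧ (∀ j, sold y j ≤ A.supply j) ∧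
      (∀ j, sold y j < A.supply j → z j = 0) ∧
      ∀ k, 0 ≤ A.surplus z k (y k) ∧ ∀ j, A.edge k j → A.value k j - z j ≤ A.surplus z k (y k) := by
  refine and_congr_right fun hy => ⟨fun h => ⟨h.nonneg, ?_, ?_, fun k => ⟨?_, fun j hj => ?_⟩⟩,
    fun ⟨h0, hs, hsl, hb⟩ => ⟨fun k => unitBundle_mem hA (hy k), fun k a ha => ?_, h0, ?_, ?_⟩⟩
  · simpa only [sold_eq] using h.feasible
  · simpa only [sold_eq] using h.slack
  · have := h.opt k (unitBundle none) (unitBundle_mem hA (by simp))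
    rwa [← surplus_eq, ← surplus_eq] at this
  · have := h.opt k (unitBundle (some j)) (unitBundle_mem hA (by simpa using hj))
    rwa [← surplus_eq, ← surplus_eq] at this
  · obtain ⟨o, rfl, ho⟩ := exists_unitBundle_eq ha
    rw [← surplus_eq, ← surplus_eq]
    rcases o with _ | j
    · exact (hb k).1
    · exact (hb k).2 j (ho j rfl)
  · simpa only [sold_eq] using hs
  · simpa only [sold_eq] using hsl

theorem isEquilibriumPrice_iff (hA : ∀ k, ∃ j, A.edge k j) : A.IsEquilibriumPrice z ↔
    ∃ y, A.IsSupportedBy z y ∧ ∀ j, sold y j = A.supply j := by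
  simp only [isSupportedBy_iff hA]
  constructor
  · rintro ⟨h0, y, h1, h2, h3⟩
    exact ⟨y, ⟨h1, h0, fun j => (h2 j).le, fun j hj => absurd (h2 j) hj.ne, h3⟩, h2⟩
  · rintro ⟨y, ⟨h1, h0, -, -, h3⟩, h2⟩
    exact ⟨h0, y, h1, h2, h3⟩

theorem IsSupportedBy.welfare_le (hA : ∀ k, ∃ j, A.edge k j) (h : A.IsSupportedBy z y)
    {y' : K → Option J} (hy' : A.IsAssignment y') : A.welfare univ y' ≤ A.welfare univ y := by
  rw [welfare_eq, welfare_eq, h.2.sum_value_eq]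
  refine (sum_value_le (s := A.supply) h.2.nonneg fun j => ?_).trans ?_
  · rw [← sold_eq]; exact hy'.2 j
  · gcongr with k
    exact h.2.opt k _ (unitBundle_mem hA (hy'.1 k))

theorem IsSupportedBy.isAssignment (h : A.IsSupportedBy z y) : A.IsAssignment y :=
  ⟨h.1, fun j => by rw [sold_eq]; exact h.2.feasible j⟩

theorem IsSupportedBy.isEfficient (hA : ∀ k, ∃ j, A.edge k j) (h : A.IsSupportedBy z y) :
    A.IsEfficient y :=
  ⟨h.isAssignment, fun _ => h.welfare_le hA⟩

theorem IsSupportedBy.of_welfare_le (hA : ∀ k, ∃ j, A.edge k j) (h : A.IsSupportedBy z y)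
    {y' : K → Option J} (hy' : A.IsAssignment y') (hle : A.welfare univ y ≤ A.welfare univ y') :
    A.IsSupportedBy z y' := by
  rw [welfare_eq, welfare_eq] at hle
  refine ⟨hy'.1, h.2.of_sum_value_le (fun k => unitBundle_mem hA (hy'.1 k)) (fun j => ?_) hle⟩
  rw [← sold_eq]; exact hy'.2 j

theorem IsSupportedBy.sold_eq_supply (h : A.IsSupportedBy z y) (hz : ∀ j, z j ≠ 0) (j : J) :
    sold y j = A.supply j := by
  rw [sold_eq]; exact h.2.sum_eq (hz j)

/-- At efficient assignments, the VCG payments are the prices of the minimum equilibrium price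
vector. -/
theorem vcgPayment_eq (hA : ∀ k, ∃ j, A.edge k j) (h : A.IsSupportedBy z y) (hz : ∀ j, z j ≠ 0)
    (hmin : ∀ z', A.IsEquilibriumPrice z' → z ≤ z') {k : K} {j : J} (hk : y k = some j) :
    A.vcgPayment y k = z j := by
  classical
  have hyk : unitBundle (y k) = Pi.single j 1 := by rw [hk]; rfl
  -- Without `k`, the same prices remain competitive at the full supply. The others alone can then
  -- attain their surplus under `y` plus the value of the whole supply, which is their welfare under
  -- `y` plus the price of `j`.
  obtain ⟨x', hx'⟩ := h.2.exists_without mConvex_unitBundles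
    (fun z' _ h' => hmin z' ((isEquilibriumPrice_iff hA).2
      ⟨y, ⟨h.1, h'⟩, h.sold_eq_supply hz⟩)) hyk ⟨j, h.1 k j hk, hyk⟩
  have hsplit : ∑ k' ∈ univ.erase k, bundleValue z (unitBundle (y k')) + z j = bundleValue z A.supply := by
    rw [← h.2.value_supply, ← sum_erase_add univ _ (mem_univ k), hyk, bundleValue_single]
  have hwelfare : A.welfare (univ.erase k) y + z j =
      ∑ k' ∈ univ.erase k, bundleValue (A.value k' - z) (unitBundle (y k')) + bundleValue z A.supply := by
    rw [welfare_eq, ← hsplit]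
    simp only [bundleValue_sub, sum_sub_distrib]
    abel
  suffices A.maxWelfare (univ.erase k) = A.welfare (univ.erase k) y + z j by
    rw [vcgPayment, sub_eq_iff_eq_add, add_comm (z j)]
    convert this
  refine le_antisymm (sup'_le _ _ fun y' hy' => ?_) ?_
  · obtain ⟨-, hy', hout⟩ := mem_filter.1 hy'
    have hnone : unitBundle (y' k) = (0 : J → ℕ) := by
      rw [hout k (notMem_erase k univ)]; rfl
    have hzero : ∀ c : J → V, bundleValue c (unitBundle (y' k)) = 0 := fun c => by
      rw [hnone]; simp [bundleValue]
    have := sum_value_le (w := A.value) (s := A.supply) (y := fun k => unitBundle (y' k))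
      h.2.nonneg fun j => by rw [← sold_eq]; exact hy'.2 j
    rw [← sum_erase_add univ _ (mem_univ k), hzero, add_zero,
      ← sum_erase_add univ (fun k => bundleValue (A.value k - z) _) (mem_univ k), hzero, add_zero] at this
    rw [welfare_eq, hwelfare]
    refine this.trans ?_
    gcongr with k'
    exact h.2.opt k' _ (unitBundle_mem hA (hy'.1 k'))
  · choose o ho hoe using fun k' => exists_unitBundle_eq (hx'.mem k')
    let y' : K → Option J := fun k' => if h : k' ≠ k then o ⟨k', h⟩ else none
    have hy'k : y' k = none := by simp [y']
    have hy'o : ∀ k' : {k' // k' ≠ k}, y' k' = o k' := fun k' => by simp [y', k'.2]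
    have hsub : ∀ f : K → V, ∑ k' ∈ univ.erase k, f k' = ∑ k' : {k' // k' ≠ k}, f k' :=
      fun f => sum_subtype _ (by simp) f
    have hmem : y' ∈ A.assignmentsOf (univ.erase k) := by
      refine mem_filter.2 ⟨mem_univ _, ⟨fun k' l hl => ?_, fun l => ?_⟩, fun k' hk' => ?_⟩
      · by_cases hkk : k' = k
        · subst hkk; simp [hy'k] at hl
        · exact hoe ⟨k', hkk⟩ l (by rw [← hl]; exact (hy'o ⟨k', hkk⟩).symm)
      · rw [sold_eq, Fintype.sum_eq_add_sum_subtype_ne _ k, hy'k]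
        simp only [hy'o, ho]
        simpa [unitBundle] using hx'.feasible l
      · obtain rfl : k' = k := by simpa using hk'
        exact hy'k
    refine le_trans (le_of_eq ?_) (le_sup' (A.welfare (univ.erase k)) hmem)
    rw [hwelfare, welfare_eq, hsub, hsub]
    simp only [hy'o, ho]
    rw [hx'.sum_value_eq]
    congr 1
    refine sum_congr rfl fun k' _ => le_antisymm ?_ ?_
    · exact hx'.opt k' _ (unitBundle_mem hA (h.1 k'))
    · exact h.2.opt k' _ (hx'.mem k')

end AssignmentMarket

namespace DiscreteConvex

variable {M V : Type*} [Fintype M] [DecidableEq M] [AddCommGroup V] [LinearOrder V]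
  [IsOrderedAddMonoid V]

/-- A part `x` of `b ∈ B` is optimal if its units are worth at least `0`, the other units of `b`
are worth at most `0`, and no exchange at `b` pays off. -/
theorem bundleValue_le_of_local {B : Set (M → ℕ)} (hB : MConvex (toInt B)) {b x : M → ℕ}
    (hb : b ∈ B) (hxb : x ≤ b) {c : M → V} (hpos : ∀ j, 0 < x j → 0 ≤ c j)
    (hneg : ∀ j, x j < b j → c j ≤ 0)
    (hloc : ∀ k l, 0 < b k → b - Pi.single k 1 + Pi.single l 1 ∈ B → c l ≤ max (c k) 0)
    {y : M → ℕ} (hy : y ∈ lowerClosure B) : bundleValue c y ≤ bundleValue c x := by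
  obtain ⟨b', hb', hyb⟩ := mem_lowerClosure.1 hy
  have hcast : ∀ d : M → ℕ, pairing (fun j => max (c j) 0) (fun j => (d j : ℤ)) =
      bundleValue (fun j => max (c j) 0) d := by
    intro d
    simp [pairing_apply, bundleValue]
  -- With free disposal only the positive part of `c` counts: `c y ≤ c⁺ y ≤ c⁺ b' ≤ c⁺ b = c x`, the
  -- third step by local optimality over `B`.
  have h1 : bundleValue (fun j => max (c j) 0) b' ≤ bundleValue (fun j => max (c j) 0) b := by
    rw [← hcast, ← hcast]
    refine hB.le_of_local ⟨b, hb, rfl⟩ (fun k l hkl => ?_) ⟨b', hb', rfl⟩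
    by_cases hlk : k = l
    · rw [hlk]
    obtain ⟨d, hd, hdb⟩ := hkl
    have hbk : 0 < b k := by
      have := congrFun hdb k
      simp [hlk] at this
      omega
    refine max_le (hloc k l hbk ?_) (le_max_right _ _)
    convert hd
    ext j
    have := congrFun hdb j
    simp only [Pi.add_apply, Pi.sub_apply, Pi.single_apply] at this ⊢
    split_ifs at this ⊢ with e1 e2 e2 <;> (try subst e1) <;> (try subst e2) <;> omega
  have h2 : bundleValue c y ≤ bundleValue (fun j => max (c j) 0) y :=
    sum_le_sum fun j _ => nsmul_le_nsmul_right (le_max_left _ _) _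
  have h3 : bundleValue (fun j => max (c j) 0) y ≤ bundleValue (fun j => max (c j) 0) b' :=
    bundleValue_mono (fun j => le_max_right _ _) hyb
  have h4 : bundleValue (fun j => max (c j) 0) b = bundleValue c x := by
    refine sum_congr rfl fun j _ => ?_
    change b j • max (c j) 0 = _
    rcases (hxb j).lt_or_eq with hlt | heq
    · rw [max_eq_right (hneg j hlt), smul_zero]
      rcases Nat.eq_zero_or_pos (x j) with h0 | h0
      · rw [h0, zero_smul]
      · rw [le_antisymm (hneg j hlt) (hpos j h0), smul_zero]
    · rcases Nat.eq_zero_or_pos (x j) with h0 | h0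
      · rw [← heq, h0, zero_smul, zero_smul]
      · rw [← heq, max_eq_left (hpos j h0)]
  exact ((h2.trans h3).trans h1).trans_eq h4

end DiscreteConvex

/-! ### Exchange markets and the main theorem. -/

namespace Market

open DiscreteConvex AssignmentMarket

variable {N M : Type*} [Fintype N] [Fintype M] [DecidableEq M] {E : Market N M} {p : M → ℝ}
  {z : M → LexReal} {x b : N → M → ℕ} {X : Finset M}

/-- The swap can be made within the used part, so a copy that gets its own good `k` does not prefer
`l`. -/
theorem IsDualPair.le_of_exchange_used (h : E.IsDualPair p E.supply z x) {i : N}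
    (hxb : x i ≤ b i) {k l : M} (hk : 0 < x i k)
    (hkl : b i - Pi.single k 1 + Pi.single l 1 ∈ E.minDemand p i) :
    E.weight p i l - z l ≤ E.weight p i k - z k := by
  have h1 := h.opt i (x i - Pi.single k 1 + Pi.single l 1) (mem_lowerClosure.2 ⟨_, hkl, fun j => by
    have : x i j ≤ b i j := hxb j
    simp only [Pi.add_apply, Pi.sub_apply]
    omega⟩)
  rw [bundleValue_add, bundleValue_exchange _ hk, bundleValue_single, sub_add,
    sub_le_self_iff] at h1
  exact sub_nonneg.1 h1

theorem IsDualPair.le_zero_of_le (h : E.IsDualPair p E.supply z x) {i : N} {l : M} {d : M → ℕ}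
    (hd : d ∈ E.minDemand p i) (hxd : x i + Pi.single l 1 ≤ d) : E.weight p i l - z l ≤ 0 := by
  have h1 := h.opt i (x i + Pi.single l 1) (mem_lowerClosure.2 ⟨d, hd, hxd⟩)
  rwa [bundleValue_add, bundleValue_single, add_le_iff_nonpos_right] at h1

/-- The swap gives up only an unused unit of `k`, so it would amount to adding `l` to `x i`; a copy
that gets nothing does not want `l`. -/
theorem IsDualPair.le_zero_of_exchange_unused (h : E.IsDualPair p E.supply z x) {i : N}
    (hxb : x i ≤ b i) {k l : M} (hk : x i k < b i k)
    (hkl : b i - Pi.single k 1 + Pi.single l 1 ∈ E.minDemand p i) :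
    E.weight p i l - z l ≤ 0 := by
  refine h.le_zero_of_le hkl fun j => ?_
  have := hxb j
  simp only [Pi.add_apply, Pi.sub_apply, Pi.single_apply] at *
  split_ifs with e1 e2 e2 <;> (try subst e1) <;> (try subst e2) <;> omega

theorem IsDualPair.le_zero_of_unused (h : E.IsDualPair p E.supply z x) {i : N}
    (hb : b i ∈ E.minDemand p i) (hxb : x i ≤ b i) {k : M} (hk : x i k < b i k) :
    E.weight p i k - z k ≤ 0 := by
  refine h.le_zero_of_le hb fun j => ?_
  have := hxb j
  simp only [Pi.add_apply, Pi.single_apply] at *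
  split_ifs with e1 <;> (try subst e1) <;> omega

/-- The assignment in which the first `x i j` copies of buyer `i` that hold `j` get `j`. -/
def copyAssignment (X : Finset M) (x b : N → M → ℕ) (k : Copies X b) : Option {j // j ∈ X} :=
  if (k.2.2 : ℕ) < x k.1 k.2.1 then some k.2.1 else none

theorem exists_edge (k : Copies X b) : ∃ j, (E.exchangeMarket p X b).edge k j :=
  ⟨k.2.1, .inl rfl⟩

theorem sold_copyAssignment (hxb : ∀ i, x i ≤ b i) (j : {j // j ∈ X}) :
    sold (copyAssignment X x b) j = ∑ i, x i j := by
  rw [sold_eq, Fintype.sum_sigma]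
  refine sum_congr rfl fun i _ => ?_
  rw [Fintype.sum_sigma, sum_eq_single j]
  · have : ∀ u : Fin (b i j), unitBundle (copyAssignment X x b ⟨i, j, u⟩) j =
        if (u : ℕ) < x i j then 1 else 0 := by
      intro u
      unfold copyAssignment
      split_ifs <;> simp [unitBundle]
    simp only [this]
    rw [Fin.sum_univ_eq_sum_range (fun u => if u < x i j then 1 else 0), sum_boole]
    have : (range (b i j)).filter (· < x i j) = range (x i j) := by
      ext u
      have : x i j ≤ b i j := hxb i j
      simp only [mem_filter, mem_range]
      omega
    simp [this]
  · intro l _ hl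
    refine sum_eq_zero fun u _ => ?_
    unfold copyAssignment
    split_ifs <;> simp [unitBundle, hl.symm]
  · simp

/-- The part of an optimal allocation on `X` is supported by the dual prices in the exchange
market. -/
theorem isSupportedBy_copyAssignment (h : E.IsDualPair p E.supply z x)
    (hb : ∀ i, b i ∈ E.minDemand p i) (hxb : ∀ i, x i ≤ b i) :
    (E.exchangeMarket p X b).IsSupportedBy (fun j => z j) (copyAssignment X x b) := by
  refine (isSupportedBy_iff exists_edge).2 ⟨fun k j hk => ?_, fun j => h.nonneg j, fun j => ?_,
    fun j hj => ?_, ?_⟩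
  · unfold copyAssignment at hk
    split_ifs at hk
    exact .inl (Option.some.inj hk).symm
  · rw [sold_copyAssignment hxb]; exact h.feasible j
  · rw [sold_copyAssignment hxb] at hj; exact h.slack j hj
  · rintro ⟨i, j, u⟩
    unfold copyAssignment
    dsimp only
    split_ifs with hu
    · have hx : 0 < x i j := (Nat.zero_le _).trans_lt hu
      refine ⟨sub_nonneg.2 (h.price_le_weight hx), fun l hl => ?_⟩
      rcases hl with rfl | hl
      · exact le_rfl
      · exact h.le_of_exchange_used (hxb i) hx hl
    · have hx : x i j < b i j := (not_lt.1 hu).trans_lt u.2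
      refine ⟨le_rfl, fun l hl => ?_⟩
      rcases hl with rfl | hl
      · exact h.le_zero_of_unused (hb i) (hxb i) hx
      · exact h.le_zero_of_exchange_unused (hxb i) hx hl

/-- Lowering the dual prices slightly towards supporting prices of the exchange market keeps the
allocation optimal. -/
theorem isDualPair_lower (h : E.IsDualPair p E.supply z x)
    (hX : ∀ j, mainPart (z j) = if j ∈ X then 1 else 0)
    (hb : ∀ i, b i ∈ E.minDemand p i) (hxb : ∀ i, x i ≤ b i) {z' : {j // j ∈ X} → LexReal}
    (h' : (E.exchangeMarket p X b).IsSupportedBy z' (copyAssignment X x b)) {S : Finset M}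
    (hSX : S ⊆ X) {δ : LexReal} (hδ : 0 ≤ δ) (hδ1 : mainPart δ ≤ 0)
    (hS : ∀ j : {j // j ∈ X}, (j : M) ∈ S → z' j ≤ z j - δ)
    (hS' : ∀ j : {j // j ∈ X}, (j : M) ∉ S → z j ≤ z' j) :
    E.IsDualPair p E.supply (fun j => if j ∈ S then z j - δ else z j) x := by
  obtain ⟨-, h0, -, -, hbest⟩ := (isSupportedBy_iff exists_edge).1 h'
  have used : ∀ i (k l : {j // j ∈ X}), 0 < x i k →
      b i - Pi.single (k : M) 1 + Pi.single (l : M) 1 ∈ E.minDemand p i →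
      E.weight p i l - z' l ≤ E.weight p i k - z' k := by
    intro i k l hk hkl
    have hu : copyAssignment X x b ⟨i, k, ⟨0, hk.trans_le (hxb i k)⟩⟩ = some k := if_pos hk
    have := (hbest ⟨i, k, ⟨0, hk.trans_le (hxb i k)⟩⟩).2 l (.inr hkl)
    rwa [hu] at this
  have unused : ∀ i (k l : {j // j ∈ X}), x i k < b i k →
      (l = k ∨ b i - Pi.single (k : M) 1 + Pi.single (l : M) 1 ∈ E.minDemand p i) →
      E.weight p i l - z' l ≤ 0 := by
    intro i k l hk hkl
    have hu : copyAssignment X x b ⟨i, k, ⟨x i k, hk⟩⟩ = none := if_neg (lt_irrefl _)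
    have := (hbest ⟨i, k, ⟨x i k, hk⟩⟩).2 l hkl
    rwa [hu] at this
  set z'' : M → LexReal := fun j => if j ∈ S then z j - δ else z j with hz''
  have hin : ∀ j ∈ S, z'' j = z j - δ := fun j hj => if_pos hj
  have hout : ∀ j ∉ S, z'' j = z j := fun j hj => if_neg hj
  have hle : ∀ j, z'' j ≤ z j := fun j => by
    by_cases hj : j ∈ S
    · rw [hin j hj]; exact sub_le_self _ hδ
    · rw [hout j hj]
  have hge : ∀ j : {j // j ∈ X}, (j : M) ∈ S → z' j ≤ z'' j := fun j hj => by
    rw [hin _ hj]; exact hS j hj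
  refine ⟨h.mem, fun i y hy => ?_, fun j => ?_, h.feasible, fun j hj => ?_⟩
  · refine bundleValue_le_of_local (E.mConvex_minDemand p i) (hb i) (hxb i)
      (fun j hj => sub_nonneg.2 ((hle j).trans (h.price_le_weight hj))) (fun j hj => ?_)
      (fun k l hk hkl => ?_) hy
    · by_cases hjS : j ∈ S
      · exact (sub_le_sub_left (hge ⟨j, hSX hjS⟩ hjS) _).trans
          (unused i ⟨j, hSX hjS⟩ ⟨j, hSX hjS⟩ hj (.inl rfl))
      · change _ - z'' j ≤ 0
        rw [hout j hjS]
        exact h.le_zero_of_unused (hb i) (hxb i) hj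
    · change _ - z'' l ≤ max (_ - z'' k) 0
      by_cases hlS : l ∈ S
      swap
      · rw [hout l hlS]
        rcases (hxb i k).lt_or_eq with hlt | heq
        · exact (h.le_zero_of_exchange_unused (hxb i) hlt hkl).trans (le_max_right _ _)
        · exact ((h.le_of_exchange_used (hxb i) (heq ▸ hk) hkl).trans
            (sub_le_sub_left (hle k) _)).trans (le_max_left _ _)
      by_cases hkX : k ∈ X
      · rcases (hxb i k).lt_or_eq with hlt | heq
        · exact ((sub_le_sub_left (hge ⟨l, hSX hlS⟩ hlS) _).trans
            (unused i ⟨k, hkX⟩ ⟨l, hSX hlS⟩ hlt (.inr hkl))).trans (le_max_right _ _)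
        · refine le_trans ?_ (le_max_left _ _)
          by_cases hkS : k ∈ S
          · rw [hin l hlS, hin k hkS, ← sub_add, ← sub_add]
            exact add_le_add (h.le_of_exchange_used (hxb i) (heq ▸ hk) hkl) le_rfl
          -- Across the boundary of `S` the comparison passes through `z'`, which is at most the
          -- lowered price at `l` and at least the old price at `k`.
          · rw [hout k hkS]
            exact ((sub_le_sub_left (hge ⟨l, hSX hlS⟩ hlS) _).trans
              (used i ⟨k, hkX⟩ ⟨l, hSX hlS⟩ (heq ▸ hk) hkl)).trans
              (sub_le_sub_left (hS' ⟨k, hkX⟩ hkS) _)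
      -- The exchange market says nothing about `k` outside `X`, but there the surplus of `k` has
      -- main part 1, and that of `l` has main part at most 0 because `δ` does.
      · refine le_trans (le_of_lt ?_) (le_max_left _ _)
        by_contra! hcon
        have := mainPart_mono hcon
        rw [map_sub, map_sub, mainPart_weight, mainPart_weight, hin l hlS,
          hout k fun hkS => hkX (hSX hkS), map_sub, hX, hX, if_pos (hSX hlS), if_neg hkX] at this
        linarith
  · by_cases hjS : j ∈ S
    · exact (h0 ⟨j, hSX hjS⟩).trans (hge ⟨j, hSX hjS⟩ hjS)
    · rw [hout j hjS]; exact h.nonneg j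
  · have hzj := h.slack j hj
    have hjS : j ∉ S := fun hjS => by
      have := hX j
      rw [hzj, if_pos (hSX hjS), map_zero] at this
      exact zero_ne_one this
    rw [hout j hjS, hzj]

/-- The dual prices are the minimum equilibrium price vector of the exchange market. -/
theorem isLeast_exchangeMarket (h : E.IsDualPair p E.supply z x)
    (hmin : ∀ z', E.IsDualPair p E.supply z' x → z ≤ z')
    (hX : ∀ j, mainPart (z j) = if j ∈ X then 1 else 0)
    (hb : ∀ i, b i ∈ E.minDemand p i) (hxb : ∀ i, x i ≤ b i) :
    IsLeast {z' | (E.exchangeMarket p X b).IsEquilibriumPrice z'}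
      (fun j : {j // j ∈ X} => z j) := by
  have hsupp := isSupportedBy_copyAssignment (X := X) h hb hxb
  have hz : ∀ j ∈ X, z j ≠ 0 := fun j hj h0 => by
    have := hX j
    rw [h0, if_pos hj, map_zero] at this
    exact zero_ne_one this
  refine ⟨(isEquilibriumPrice_iff exists_edge).2
    ⟨_, hsupp, hsupp.sold_eq_supply fun j => hz j j.2⟩, fun z' hz' => ?_⟩
  obtain ⟨y', hy', -⟩ := (isEquilibriumPrice_iff exists_edge).1 hz'
  -- Both assignments maximize welfare, so `z'` also supports the assignment read off from `x`.
  have h' := hy'.of_welfare_le exists_edge hsupp.isAssignment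
    (hsupp.welfare_le exists_edge hy'.isAssignment)
  by_contra hlt
  obtain ⟨j₀, hj₀⟩ : ∃ j : {j // j ∈ X}, z' j < z j := by
    by_contra! hge
    exact hlt hge
  classical
  let S : Finset {j // j ∈ X} := univ.filter fun j => z' j < z j
  have hSmem : ∀ j : {j // j ∈ X}, (j : M) ∈ S.map (Function.Embedding.subtype _) ↔
      z' j < z j := by
    intro j
    simp [S]
  obtain ⟨j₁, hj₁, hmin₁⟩ := S.exists_min_image (fun j => z j - z' j)
    ⟨j₀, by simpa [S] using hj₀⟩
  -- Lower by the smallest positive gap `z - z'`, capped at the infinitesimal `γ` so that the main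
  -- parts do not move.
  have hε : (0 : LexReal) < toLex (0, 1) := Prod.Lex.lt_iff.2 (.inr ⟨rfl, zero_lt_one⟩)
  have hδ : 0 < min (z j₁ - z' j₁) (toLex (0, 1)) :=
    lt_min (sub_pos.2 (by simpa [S] using hj₁)) hε
  have hlow := isDualPair_lower (S := S.map (Function.Embedding.subtype _))
    (δ := min (z j₁ - z' j₁) (toLex (0, 1))) h hX hb hxb h' (fun j hj => ?_) hδ.le
    (mainPart_mono (min_le_right _ _)) (fun j hj => ?_) (fun j hj => ?_)
  · have := hmin _ hlow j₀
    simp only [(hSmem j₀).2 hj₀, if_true] at this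
    exact absurd this (not_le.2 (sub_lt_self _ hδ))
  · obtain ⟨l, -, rfl⟩ := mem_map.1 hj
    exact l.2
  · have := hmin₁ j (by simpa [S] using (hSmem j).1 hj)
    rw [le_sub_comm]
    exact (min_le_left _ _).trans this
  · exact not_lt.1 fun hlt => hj ((hSmem j).2 hlt)

end Market

theorem mainTheorem11 {N M : Type*} [Fintype N] [Fintype M] [DecidableEq M]
    (E : Market N M) (p : M → ℝ) (hp : 0 ≤ p)
    (X : Finset M) (hX : Minimal (E.IsMaxOverDemanded p) X) :
    ∃ z : M → LexReal,
      -- `z` is the minimal dual solution; its first component is the indicator of `X`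
      IsLeast (minimizers (E.dualObjective p)) z ∧
      (∀ j, (ofLex (z j)).1 = if j ∈ X then 1 else 0) ∧
      -- its restriction to `X` is the least minimizer of the Lyapunov function
      IsLeast (minimizers (lyapunov (E.auxSupply X) (E.auxValuation p X)))
        (fun j : {j // j ∈ X} => z j) ∧
      -- and the minimum equilibrium price vector of the auxiliary frictionless market
      IsLeast {z' | IsEquilibriumPrice (E.auxSupply X) (E.auxValuation p X) z'}
        (fun j : {j // j ∈ X} => z j) ∧
      -- it encodes the direction
      (∀ j ∈ X, 0 < Market.direction z j ∧
        z j = toLex (1, Real.log (Market.direction z j))) ∧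
      (∀ j, j ∉ X → Market.direction z j = 0) ∧
      -- auxiliary assignment markets exist
      (∃ x b : N → M → ℕ, E.IsOptimalPrimal p x ∧ ∀ i, b i ∈ E.minDemand p i ∧ x i ≤ b i) ∧
      -- in each of them it is the minimum equilibrium price vector, and the VCG price vector
      ∀ x b : N → M → ℕ, E.IsOptimalPrimal p x →
        (∀ i, b i ∈ E.minDemand p i ∧ x i ≤ b i) →
        IsLeast {z' | (E.exchangeMarket p X b).IsEquilibriumPrice z'}
          (fun j : {j // j ∈ X} => z j) ∧
        (∃ y, (E.exchangeMarket p X b).IsEfficient y) ∧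
        ∀ y, (E.exchangeMarket p X b).IsEfficient y → ∀ j : {j // j ∈ X},
          (∃ k, y k = some j) ∧
          ∀ k, y k = some j → (E.exchangeMarket p X b).vcgPayment y k = z j := by
  open DiscreteConvex AssignmentMarket Market in
  obtain ⟨z, ⟨x₀, h⟩, haug⟩ := exists_isCompetitive (fun i => E.mConvex_minDemand p i)
    (fun i => E.minDemand_nonempty p i) (E.weight p) E.supply
  have hmain := mainPart_price h haug hX
  have hz : ∀ j ∈ X, z j ≠ 0 := fun j hj h0 => by
    have := hmain j
    rw [h0, if_pos hj, map_zero] at this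
    exact zero_ne_one this
  -- If `j` in `X` had no supply, an added unit would still be sold because its price is nonzero;
  -- but demanded bundles contain no units of `j`.
  have hpos : ∀ j ∈ X, E.supply j ≠ 0 := by
    intro j hj hs
    obtain ⟨x', h'⟩ := haug j
    have hsum := h'.sum_eq (hz j hj)
    rw [sum_eq_zero fun i _ => Nat.le_zero.1 ((le_supply_of_mem (h'.mem i) j).trans_eq hs)] at hsum
    simp at hsum
  have haux := isLeast_auxiliary h haug hmain
  refine ⟨z, isLeast_dualObjective h haug, hmain, haux.1, haux.2, fun j hj => ?_, fun j hj => ?_,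
    exists_isOptimalPrimal, fun x b hx hb => ?_⟩
  · have h1 : (ofLex (z j)).1 = 1 := (hmain j).trans (if_pos hj)
    have hd : direction z j = Real.exp (ofLex (z j)).2 := if_pos h1
    rw [hd, Real.log_exp]
    exact ⟨Real.exp_pos _, by rw [← h1]; rfl⟩
  · have h1 : (ofLex (z j)).1 = 0 := (hmain j).trans (if_neg hj)
    exact if_neg (by rw [h1]; exact zero_ne_one)
  · have hpair := hx.isDualPair h
    have hleast := isLeast_exchangeMarket (X := X) (b := b) hpair (fun z' h' j => by
      obtain ⟨x', hx'⟩ := haug j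
      exact hpair.price_le_of_isCompetitive hx' h') hmain (fun i => (hb i).1) fun i => (hb i).2
    have hsupp := isSupportedBy_copyAssignment (X := X) hpair (fun i => (hb i).1)
      fun i => (hb i).2
    refine ⟨hleast, ⟨_, hsupp.isEfficient exists_edge⟩, fun y hy j => ?_⟩
    have hy' := hsupp.of_welfare_le exists_edge hy.1 (hy.2 _ hsupp.isAssignment)
    refine ⟨?_, fun k hk => vcgPayment_eq exists_edge hy' (fun j => hz j j.2)
      (fun z' h' => hleast.2 h') hk⟩
    have hsold := hy'.sold_eq_supply (fun j => hz j j.2) j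
    by_contra! hno
    -- The good is sold out and its supply is positive, so some copy gets it.
    exact hpos j j.2 (hsold.symm.trans (by simp [sold, hno]))

end
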